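/- **Conventions.** For $C_0>0$ and $M\ge 1$ put $\mathfrak h_M=C_0/\sqrt M$. $\|x\|$ is the Euclidean norm on $\mathbb R^d$, and $\|\cdot\|_\infty$ is the max-norm of tensors in $\mathbb R^{n\times\cdots\times n}$ ($d$ factors). A Gaussian sum $\sum_{k=-M}^{M}w_k e^{-g_k\|x\|^2}$ is separable of rank $2M+1$: it equals $\sum_{k=-M}^{M}w_k\prod_{\ell=1}^d e^{-g_kx_\ell^2}$. **(1) Sinc quadrature on the line.** Let $D,b,C_0>0$. There are $C,\beta>0$, depending only on $D,b,C_0$, such that the following holds. Let $p_0>0$, let $q(p)=\int_{\mathbb R}a_1(t)e^{-p^2a_2(t)}\,dt$ for $p\ge p_0$, where $a_1,a_2>0$ on $\mathbb R$ extend analytically to the strip $|\mathrm{Im}\, z|<D$, and suppose that for all $p\ge p_0$ one has $|a_1(z)e^{-p^2a_2(z)}|\le B$ in the strip and $a_1(t)e^{-p^2a_2(t)}\le Be^{-b|t|}$ for $t\in\mathbb R$. Then the integrals converge, and for all $d$, all $M\ge1$ and all $x\in\mathbb R^d$ with $\|x\|\ge p_0$, with $t_k=k\mathfrak h_M$, $$\Big|q(\|x\|)-\sum_{k=-M}^{M}\mathfrak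 h_M\,a_1(t_k)\,e^{-a_2(t_k)\|x\|^2}\Big|\le C\,B\,e^{-\beta\sqrt M}.$$ **(2) Laplace–Gauss transforms.** Let $\delta,s,C_0>0$ and $m\ge0$. There are $C,\beta>0$, depending only on $\delta,s,m,C_0$, such that the following holds. Let $q(p)=\int_0^\infty a(t)e^{-t^2p^2}\,dt$ (convergent) for all $p>0$, where $a>0$ on $(0,\infty)$ extends to an analytic function in the sector $|\arg z|<\delta$, $z\neq0$, with $|a(z)|\le K|z|^{s-1}(1+|z|)^m$ there. For $a_0>0$ and $M\ge1$ put $$t_k=e^{k\mathfrak h_M}/a_0,\qquad a_k=\mathfrak h_M\,t_k\,a(t_k),\qquad -M\le k\le M .$$ Then for all $d$ and all $x\in\mathbb R^d$ with $\|x\|\ge a_0$, $$\Big|q(\|x\|)-\sum_{k=-M}^{M}a_ke^{-t_k^2\|x\|^2}\Big|\le C\,K\,a_0^{-s}\,(1+1/a_0)^m\,e^{-\beta\sqrt M}.$$ In particular, for $a$ bounded by $K$ in the sector ($s=1$, $m=0$), the bound is $\frac{CK}{a_0}e^{-\beta\sqrt M}$. **(3) Tensor approximation.** Let $d\ge1$,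 let $a,q$ be as in (2) with $s+m<d$, and let $a_0,b,C_0>0$. For $n\ge1$ let $\psi_{\mathbf i}(x)=\prod_{\ell=1}^d\psi_{i_\ell}(x_\ell)$ be the characteristic functions of the $n^d$ cells of the uniform grid of mesh size $2b/n$ in $[-b,b)^d$, and put $$\mathbf Q=[q_{\mathbf i}],\quad q_{\mathbf i}=\int_{\mathbb R^d}\psi_{\mathbf i}(x)q(\|x\|)\,dx,\qquad \mathbf Q_R=\sum_{k=-M}^{M}\mathbf q_k\otimes\cdots\otimes\mathbf q_k,\quad \mathbf q_k=a_k^{1/d}\Big[\int_{\mathbb R}\psi_j(y)e^{-t_k^2y^2}dy\Big]_{j=1}^n .$$ Then the integrals $q_{\mathbf i}$ converge. The tensor $\mathbf Q_R=\sum_{k}a_k\bigotimes_{\ell}\big[\int\psi_j(y)e^{-t_k^2y^2}dy\big]_j$ has a canonical (CP) representation $\sum_{k=1}^{R}\xi_k\,\mathbf u_k^{(1)}\otimes\cdots\otimes\mathbf u_k^{(d)}$ with $R=2M+1$ terms and unit vectors $\mathbf u_k^{(\ell)}$, and an orthogonal Tucker representation (core tensor in $\mathbb R^{r_1\times\cdots\times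 r_d}$, orthonormal vectors in each direction) of ranks $r_\ell\le 2M+1$. Moreover $$\|\mathbf Q-\mathbf Q_R\|_\infty\le C\,K\,e^{-\beta\sqrt M}\qquad(M\ge1,\ n\ge1),$$ with $C,\beta>0$ depending only on $d,\delta,s,m,C_0,a_0,b$. For every $n$ and every $\varepsilon>0$, $\|\mathbf Q-\mathbf Q_R\|_\infty\le\varepsilon\|\mathbf Q\|_\infty$ for all sufficiently large $M$. **(4) Kernels of Matérn type.** Let $d\ge1$. The following functions are Laplace–Gauss transforms $q(p)=\int_0^\infty a(t)e^{-t^2p^2}dt$ ($p>0$, convergent integrals): * the Matérn spectral density $q(\rho)=c\,(\alpha^2+\rho^2)^{-(\nu+d/2)}$, $c,\alpha>0$, $\nu\ge0$, with $a(t)=\frac{2c}{\Gamma(\nu+d/2)}t^{2\nu+d-1}e^{-\alpha^2t^2}$; * the Slater function $q(r)=e^{-2\sqrt\alpha\, r}$, $\alpha>0$, with $a(t)=\frac{2\sqrt\alpha}{\sqrt\pi}t^{-2}e^{-\alpha/t^2}$; * the Matérn covariance $q(r)=\frac{2^{1-\nu}}{\Gamma(\nu)}\big(\frac{\sqrt{2\nu}r}{\ell}\big)^{\nu}K_\nu\big(\frac{\sqrt{2\nu}r}{\ell}\big)$,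 $\nu,\ell>0$, where $K_\nu(z)=\int_0^\infty e^{-z\cosh t}\cosh(\nu t)\,dt$, with $a(t)=\frac{2}{\Gamma(\nu)}\big(\frac{\nu}{2\ell^2}\big)^{\nu}t^{-2\nu-1}e^{-\nu/(2\ell^2t^2)}$. For each of them and each $C_0>0$, with $t_k,a_k$ as in (2), there are $C,\beta>0$, independent of $a_0$, $M$ and $x$, with $$\Big|q(\|x\|)-\sum_{k=-M}^{M}a_ke^{-t_k^2\|x\|^2}\Big|\le\frac{C}{a_0}e^{-\beta\sqrt M}\qquad(a_0>0,\ M\ge1,\ x\in\mathbb R^d,\ \|x\|\ge a_0),$$ and, for all $a_0,b>0$, the tensors $\mathbf Q,\mathbf Q_R$ of (3) satisfy all conclusions of (3), with $\|\mathbf Q-\mathbf Q_R\|_\infty\le Ce^{-\beta\sqrt M}$ for all $M,n\ge1$ and some $C,\beta>0$ independent of $M$ and $n$. -/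

import Mathlib

open MeasureTheory Set

namespace SincTensor

noncomputable section

/-- The open horizontal strip of half-width `D` around the real axis. -/
def strip (D : ℝ) : Set ℂ := {z | |z.im| < D}

/-- The open sector of half-angle `δ` around the positive real axis. -/
def sector (δ : ℝ) : Set ℂ := {z | z ≠ 0 ∧ |z.arg| < δ}

/-- The step size `C₀ / √M` of the sinc quadrature with `2M+1` nodes. -/
def step (C₀ : ℝ) (M : ℕ) : ℝ := C₀ / Real.sqrt M

/-- The Gaussian sum `∑_{k=-M}^{M} w_k exp (-g_k ‖x‖²)` with `2M+1` terms. -/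
def gaussSum {d : ℕ} (w g : ℤ → ℝ) (M : ℕ) (x : EuclideanSpace ℝ (Fin d)) : ℝ :=
  ∑ k ∈ Finset.Icc (-(M : ℤ)) (M : ℤ), w k * Real.exp (-(g k * ‖x‖ ^ 2))

/-! ### The sinc quadrature on the line, for `∫_ℝ a₁(t) exp (-p² a₂(t)) dt` -/

/-- Positive weights `a₁, a₂` that extend analytically to the strip of half-width `D`, such that
for all `p ≥ p₀` the integrand `a₁ exp (-p² a₂)` is bounded by `B` in the strip and decays
exponentially, with rate `b`, on the real axis. -/
structure StripWeights (a₁ a₂ : ℝ → ℝ) (D b p₀ B : ℝ) : Prop where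
  pos₁ : ∀ t, 0 < a₁ t
  pos₂ : ∀ t, 0 < a₂ t
  analytic : ∃ A₁ A₂ : ℂ → ℂ,
    DifferentiableOn ℂ A₁ (strip D) ∧ DifferentiableOn ℂ A₂ (strip D) ∧
    (∀ t : ℝ, A₁ (t : ℂ) = (a₁ t : ℂ)) ∧ (∀ t : ℝ, A₂ (t : ℂ) = (a₂ t : ℂ)) ∧
    ∀ p : ℝ, p₀ ≤ p → ∀ z ∈ strip D, ‖A₁ z * Complex.exp (-((p : ℂ) ^ 2 * A₂ z))‖ ≤ B
  decay : ∀ p : ℝ, p₀ ≤ p → ∀ t : ℝ,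
    a₁ t * Real.exp (-(p ^ 2 * a₂ t)) ≤ B * Real.exp (-(b * |t|))

/-! ### The Laplace–Gauss transform and its sinc quadrature -/

/-- `q(p) = ∫_0^∞ a(t) exp (-t² p²) dt`, with a convergent integral, for every `p > 0`. -/
def IsLaplaceGauss (a q : ℝ → ℝ) : Prop :=
  ∀ p : ℝ, 0 < p →
    IntegrableOn (fun t : ℝ => a t * Real.exp (-(t ^ 2 * p ^ 2))) (Ioi 0) ∧
    q p = ∫ t in Ioi (0 : ℝ), a t * Real.exp (-(t ^ 2 * p ^ 2))

/-- A positive weight on `(0, ∞)` that extends to an analytic function of at most polynomial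
growth in a sector (the substitution `t = eᵘ` maps a strip onto the sector):
`|a(z)| ≤ K |z|^(s-1) (1+|z|)^m`. -/
structure SectorWeight (a : ℝ → ℝ) (δ s m K : ℝ) : Prop where
  pos : ∀ t : ℝ, 0 < t → 0 < a t
  analytic : ∃ A : ℂ → ℂ, DifferentiableOn ℂ A (sector δ) ∧
    (∀ t : ℝ, 0 < t → A (t : ℂ) = (a t : ℂ)) ∧
    ∀ z ∈ sector δ, ‖A z‖ ≤ K * ‖z‖ ^ (s - 1) * (1 + ‖z‖) ^ m

/-- Quadrature points `t_k = e^{kh} / a₀` of the sinc quadrature on the half-line: the points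
`u_k = k h` on the real line, transported by `t = eᵘ / a₀`. -/
def node (a₀ h : ℝ) (k : ℤ) : ℝ := Real.exp (k * h) / a₀

/-- Quadrature weights `a_k = h t_k a(t_k)`. -/
def weight (a : ℝ → ℝ) (a₀ h : ℝ) (k : ℤ) : ℝ := h * node a₀ h k * a (node a₀ h k)

/-! ### Tensors, the canonical (CP) and the Tucker format -/

/-- `A = ∑_{k=1}^{R} ξ_k u_k^{(1)} ⊗ ⋯ ⊗ u_k^{(d)}` with normalized vectors. -/
def HasCPForm {d n : ℕ} (A : (Fin d → Fin n) → ℝ) (R : ℕ) : Prop :=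
  ∃ (ξ : Fin R → ℝ) (u : Fin d → Fin R → EuclideanSpace ℝ (Fin n)),
    (∀ l k, ‖u l k‖ = 1) ∧ ∀ i, A i = ∑ k, ξ k * ∏ l, u l k (i l)

/-- The orthogonal Tucker format of rank `(r_1, …, r_d)` with core tensor `B`. -/
def HasTuckerForm {d n : ℕ} (A : (Fin d → Fin n) → ℝ) (r : Fin d → ℕ) : Prop :=
  ∃ (B : (∀ l, Fin (r l)) → ℝ) (v : ∀ l, Fin (r l) → EuclideanSpace ℝ (Fin n)),
    (∀ l, Orthonormal ℝ (v l)) ∧ ∀ i, A i = ∑ ν, B ν * ∏ l, v l (ν l) (i l)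

/-! ### Discretization on the uniform grid with `n^d` cells in `[-b,b]^d` -/

/-- Univariate piecewise constant basis function: the characteristic function of the `j`-th
interval of length `2b/n` in `[-b,b)`, `j = 0, …, n-1`. -/
def psi₁ (b : ℝ) (n : ℕ) (j : Fin n) : ℝ → ℝ :=
  indicator (Ico (-b + (j : ℝ) * (2 * b / n)) (-b + ((j : ℝ) + 1) * (2 * b / n))) 1

/-- Tensor-product piecewise constant basis function. -/
def psi {d : ℕ} (b : ℝ) (n : ℕ) (i : Fin d → Fin n) (x : EuclideanSpace ℝ (Fin d)) : ℝ :=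
  ∏ l, psi₁ b n (i l) (x l)

/-- The projection tensor `q_i = ∫ ψ_i(x) q(‖x‖) dx` of a radial kernel. -/
def projTensor (d n : ℕ) (b : ℝ) (q : ℝ → ℝ) : (Fin d → Fin n) → ℝ :=
  fun i => ∫ x : EuclideanSpace ℝ (Fin d), psi b n i x * q ‖x‖

/-- `b_j(τ) = ∫ ψ_j(y) exp (-τ² y²) dy`. -/
def gaussVec (b : ℝ) (n : ℕ) (τ : ℝ) (j : Fin n) : ℝ :=
  ∫ y : ℝ, psi₁ b n j y * Real.exp (-(τ ^ 2 * y ^ 2))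

/-- The skeleton vector `a_k^{1/d} b(t_k)`, the same one in each of the `d` directions. -/
def skeleton (d n : ℕ) (b : ℝ) (a : ℝ → ℝ) (a₀ h : ℝ) (k : ℤ) (j : Fin n) : ℝ :=
  weight a a₀ h k ^ (1 / (d : ℝ)) * gaussVec b n (node a₀ h k) j

/-- The symmetric tensor `∑_{k=-M}^{M} q_k ⊗ ⋯ ⊗ q_k` of the skeleton vectors. -/
def sincTensor (d n : ℕ) (b : ℝ) (a : ℝ → ℝ) (a₀ h : ℝ) (M : ℕ) : (Fin d → Fin n) → ℝ :=
  fun i => ∑ k ∈ Finset.Icc (-(M : ℤ)) (M : ℤ), ∏ l, skeleton d n b a a₀ h k (i l)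

/-- The sinc tensor is a rank-`(2M+1)` canonical tensor, hence a Tucker tensor of ranks at most
`2M+1`, and approximates the projection tensor within `ε` in the max-norm (the norm of the
function space `(Fin d → Fin n) → ℝ`). -/
structure SincTensorApprox (d n : ℕ) (b : ℝ) (q a : ℝ → ℝ) (a₀ h : ℝ) (M : ℕ) (ε : ℝ) :
    Prop where
  integrable : ∀ i : Fin d → Fin n,
    Integrable (fun x : EuclideanSpace ℝ (Fin d) => psi b n i x * q ‖x‖)
  expansion : ∀ i : Fin d → Fin n, sincTensor d n b a a₀ h M i =
    ∑ k ∈ Finset.Icc (-(M : ℤ)) (M : ℤ),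
      weight a a₀ h k * ∏ l, gaussVec b n (node a₀ h k) (i l)
  cp : HasCPForm (sincTensor d n b a a₀ h M) (2 * M + 1)
  tucker : ∃ r : Fin d → ℕ, (∀ l, r l ≤ 2 * M + 1) ∧
    HasTuckerForm (sincTensor d n b a a₀ h M) r
  error : ‖projTensor d n b q - sincTensor d n b a a₀ h M‖ ≤ ε

/-! ### Kernels of Matérn type -/

/-- The modified Bessel function of the second kind `K_ν(z)` for `z > 0`. -/
def besselK (ν z : ℝ) : ℝ :=
  ∫ t in Ioi (0 : ℝ), Real.exp (-(z * Real.cosh t)) * Real.cosh (ν * t)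

/-- The Matérn covariance function `C_{ν,ℓ}(r)`, `r > 0`. -/
def maternCov (ν ell r : ℝ) : ℝ :=
  2 ^ (1 - ν) / Real.Gamma ν * (Real.sqrt (2 * ν) * r / ell) ^ ν *
    besselK ν (Real.sqrt (2 * ν) * r / ell)

/-- The kernels `q` on `ℝ^d` of Matérn type, with their Laplace–Gauss weights `a`: the spectral
density `c (α²+ρ²)^{-(ν+d/2)}` of the Matérn covariance, the Slater function (exponential
covariance) `exp (-2 √α r)`, and the Matérn covariance `C_{ν,ℓ}(r)` itself. -/
inductive MaternType (d : ℕ) : (ℝ → ℝ) → (ℝ → ℝ) → Prop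
  | spectral (c α ν : ℝ) (hc : 0 < c) (hα : 0 < α) (hν : 0 ≤ ν) :
      MaternType d (fun ρ => c / (α ^ 2 + ρ ^ 2) ^ (ν + (d : ℝ) / 2))
        (fun t => 2 * c / Real.Gamma (ν + (d : ℝ) / 2) * t ^ (2 * ν + (d : ℝ) - 1) *
          Real.exp (-(α ^ 2 * t ^ 2)))
  | slater (α : ℝ) (hα : 0 < α) :
      MaternType d (fun r => Real.exp (-(2 * Real.sqrt α * r)))
        (fun t => 2 * Real.sqrt α / Real.sqrt Real.pi * t ^ (-2 : ℝ) *
          Real.exp (-(α / t ^ 2)))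
  | covariance (ν ell : ℝ) (hν : 0 < ν) (hell : 0 < ell) :
      MaternType d (fun r => maternCov ν ell r)
        (fun t => 2 / Real.Gamma ν * (ν / (2 * ell ^ 2)) ^ ν * t ^ (-(2 * ν) - 1) *
          Real.exp (-(ν / (2 * ell ^ 2) / t ^ 2)))

end

end SincTensor

/-! The engine is the trapezoidal rule with step `h` for a function holomorphic in a strip of
half-width `D` and decaying like `e^{-b|t|}` on the real axis. By Poisson summation, the error of
the infinite rule is the sum of the Fourier transform over the nonzero frequencies `n/h`, and
shifting the contour makes this of order `e^{-πD/(2h)}`. Truncation to `|k| ≤ M` costs about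
`e^{-bhM}`. With `h = C₀/√M` both errors are `e^{-β√M}` (`exists_sinc_quadrature_bound`). The shift
needs decay off the real axis, whereas the hypotheses give only boundedness there; Phragmén–Lindelöf
interpolates between the two (`norm_le_exp_of_strip`).

The substitution `t = e^u/a₀` turns the half-line into the line and a sector into a strip, and power
behaviour at `0` and `∞` into exponential decay in `u` (`exists_sector_quadrature_bound`). In a
sector of half-angle at most `π/6` the Gaussian `e^{-z²p²}` is bounded by `e^{-|z|²p²/2}`, so
polynomially growing weights are admissible as soon as `p ≥ a₀`.

For tensors the pointwise estimate is not enough, because cells near the origin contain points with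
`‖x‖ < a₀`. By Fubini each entry is itself a half-line integral, of `a(t)` times a product of `d`
one-dimensional Gaussian integrals. Each factor is bounded by a constant and by a constant over
`|t|`, so the product decays like `|t|^{-d}`; this beats `|t|^{s+m-1}` since `s + m < d`, and the
quadrature applies to the entry directly, uniformly in the grid. Separability of the Gaussian then
gives the CP and Tucker forms.

The Matérn kernels are covered by explicit weights of the form power times `e^{-γt²}` or
`e^{-γ/t²}`; the representations follow from the Gamma integral and from the integral defining
`K_ν`. -/

namespace SincTensor

/-! ### Exponential decay inside a strip. -/

open Complex in
/-- Two-constants bound: a bounded holomorphic function on the strip `0 ≤ Im z ≤ D` which decays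
exponentially on the real axis decays exponentially inside the strip. -/
theorem norm_le_exp_of_upper_strip {f : ℂ → ℂ} {D b B σ : ℝ} (hD : 0 < D) (hb : 0 < b)
    (hσ : |σ| = 1)
    (hf : DiffContOnCl ℂ f (Complex.im ⁻¹' Ioo 0 D)) (hB : ∀ z : ℂ, 0 ≤ z.im → z.im ≤ D → ‖f z‖ ≤ B)
    (hdec : ∀ t : ℝ, ‖f t‖ ≤ B * Real.exp (-(b * |t|))) {z : ℂ} (h0 : 0 ≤ z.im) (h1 : z.im ≤ D) :
    ‖f z‖ ≤ B * Real.exp (-(σ * b * z.re * (1 - z.im / D))) := by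
  have hB0 : 0 ≤ B := (norm_nonneg _).trans (hB 0 (by simp) (by simp [hD.le]))
  -- The multiplier `e^g` has `Re g = σ b x (1 - y/D)`: on the real axis it at most cancels the
  -- decay of `f`, and on the line `y = D` it has modulus one. The sign `σ` selects the end of the
  -- strip at which decay is wanted.
  set g : ℂ → ℂ := fun z => ((σ * b : ℝ) : ℂ) * (z + I * z ^ 2 / ((2 * D : ℝ) : ℂ)) with hg
  have hgre : ∀ z : ℂ, (g z).re = σ * b * z.re * (1 - z.im / D) := by
    intro z
    have : (z + I * z ^ 2 / ((2 * D : ℝ) : ℂ)).re = z.re - z.re * z.im / D := by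
      rw [add_re, div_ofReal_re]
      simp [pow_two]
      field_simp
      ring
    rw [hg]
    simp only [re_ofReal_mul, this]
    ring
  have hσ' : ∀ x : ℝ, σ * x ≤ |x| := fun x => by
    calc σ * x ≤ |σ * x| := le_abs_self _
      _ = |x| := by rw [abs_mul, hσ, one_mul]
  have hgd : Differentiable ℂ g := by
    rw [hg]; fun_prop
  have key : ‖f z * cexp (g z)‖ ≤ B := by
    refine PhragmenLindelof.horizontal_strip (a := 0) (b := D) (f := fun z => f z * cexp (g z))
      ?_ ?_ ?_ ?_ h0 h1
    · exact hf.smul hgd.cexp.diffContOnCl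
    -- Phragmén–Lindelöf tolerates growth `exp(A e^{c|x|})` with `c < π/D`. Here the growth is only
    -- `e^{b|x|}`, and `b|x| ≤ (b/c) e^{c|x|}` with `c = π/(2D)`.
    · have hc : 0 < Real.pi / (2 * D) := by positivity
      refine ⟨Real.pi / (2 * D), ?_, b / (Real.pi / (2 * D)), ?_⟩
      · rw [sub_zero]
        exact div_lt_div_of_pos_left Real.pi_pos hD (by linarith)
      · refine Asymptotics.IsBigO.of_bound B ?_
        refine Filter.Eventually.filter_mono inf_le_right ?_
        rw [Filter.eventually_principal]
        intro w hw
        simp only [mem_preimage, mem_Ioo] at hw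
        rw [norm_mul, norm_exp, hgre, Real.norm_eq_abs, abs_of_pos (Real.exp_pos _)]
        refine mul_le_mul (hB w hw.1.le hw.2.le) (Real.exp_le_exp.mpr ?_) (Real.exp_pos _).le hB0
        · have h3 : 0 ≤ w.im / D := div_nonneg hw.1.le hD.le
          have h4 : w.im / D ≤ 1 := (div_le_one hD).mpr hw.2.le
          have h5 := Real.add_one_le_exp (Real.pi / (2 * D) * |w.re|)
          calc σ * b * w.re * (1 - w.im / D) = b * ((σ * w.re) * (1 - w.im / D)) := by ring
            _ ≤ b * (|w.re| * 1) := by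
              refine mul_le_mul_of_nonneg_left ?_ hb.le
              exact mul_le_mul (hσ' _) (by linarith) (by linarith) (abs_nonneg _)
            _ = b / (Real.pi / (2 * D)) * (Real.pi / (2 * D) * |w.re|) := by field_simp
            _ ≤ _ := by
              refine mul_le_mul_of_nonneg_left ?_ (by positivity)
              linarith
    · intro w hw
      have hw' : w = (w.re : ℂ) := by apply Complex.ext <;> simp [hw]
      rw [norm_mul, norm_exp, hgre, hw, zero_div, sub_zero, mul_one]
      have := hdec w.re
      rw [← hw'] at this
      calc _ ≤ B * Real.exp (-(b * |w.re|)) * Real.exp (b * |w.re|) := by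
            have h2 := mul_le_mul_of_nonneg_left (hσ' w.re) hb.le
            exact mul_le_mul this (Real.exp_le_exp.mpr (by linarith)) (Real.exp_pos _).le
              (by positivity)
        _ = B := by rw [mul_assoc, ← Real.exp_add]; simp
    · intro w hw
      rw [norm_mul, norm_exp, hgre, hw, div_self hD.ne', sub_self, mul_zero, Real.exp_zero, mul_one]
      exact hB w (by rw [hw]; exact hD.le) hw.le
  rw [norm_mul, norm_exp, hgre] at key
  rwa [Real.exp_neg, ← div_eq_mul_inv, le_div_iff₀ (Real.exp_pos _)]

theorem ofReal_mem_strip {D : ℝ} (hD : 0 < D) (t : ℝ) : (t : ℂ) ∈ strip D := by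
  simpa [strip] using hD

/-- The two-constants bound is used on width `D/2`, whose closed strip still lies in the open
domain. For `y ≤ D/4` the factor `1 - y/(D/2)` is at least `1/2`, hence the rate `b/2`. The lower
half follows from `z ↦ -z`. -/
theorem norm_le_exp_of_strip {f : ℂ → ℂ} {D b B : ℝ} (hD : 0 < D) (hb : 0 < b)
    (hf : DifferentiableOn ℂ f (strip D)) (hB : ∀ z ∈ strip D, ‖f z‖ ≤ B)
    (hdec : ∀ t : ℝ, ‖f t‖ ≤ B * Real.exp (-(b * |t|))) {z : ℂ} (hz : |z.im| ≤ D / 4) :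
    ‖f z‖ ≤ B * Real.exp (-(b / 2 * |z.re|)) := by
  have hB0 : 0 ≤ B := (norm_nonneg _).trans (hB 0 (by simp [strip, hD]))
  have aux : ∀ f : ℂ → ℂ, DifferentiableOn ℂ f (strip D) → (∀ z ∈ strip D, ‖f z‖ ≤ B) →
      (∀ t : ℝ, ‖f t‖ ≤ B * Real.exp (-(b * |t|))) → ∀ z : ℂ, 0 ≤ z.im → z.im ≤ D / 4 →
      ‖f z‖ ≤ B * Real.exp (-(b / 2 * |z.re|)) := by
    intro f hf hB hdec z h0 h1
    obtain ⟨σ, hσ, hσz⟩ : ∃ σ : ℝ, |σ| = 1 ∧ σ * z.re = |z.re| := by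
      rcases le_total 0 z.re with h | h
      · exact ⟨1, by simp, by simp [abs_of_nonneg h]⟩
      · exact ⟨-1, by simp, by simp [abs_of_nonpos h]⟩
    have hcl : closure (Complex.im ⁻¹' Ioo 0 (D / 2)) ⊆ strip D := by
      refine (closure_minimal (t := Complex.im ⁻¹' Icc 0 (D / 2))
        (preimage_mono Ioo_subset_Icc_self)
        (isClosed_Icc.preimage Complex.continuous_im)).trans ?_
      intro w hw
      simp only [mem_preimage, mem_Icc] at hw
      simp only [strip, mem_ofPred_eq, abs_lt]
      constructor <;> linarith
    refine (norm_le_exp_of_upper_strip (D := D / 2) (half_pos hD) hb hσ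
      (hf.mono hcl).diffContOnCl ?_ hdec h0 (by linarith)).trans ?_
    · intro w hw0 hw1
      exact hB w (by simp only [strip, mem_ofPred_eq, abs_lt]; constructor <;> linarith)
    · refine mul_le_mul_of_nonneg_left (Real.exp_le_exp.mpr (neg_le_neg ?_)) hB0
      have h2 : z.im / (D / 2) ≤ 1 / 2 := by
        rw [div_le_iff₀ (half_pos hD)]; linarith
      have h3 : 0 ≤ b * |z.re| := by positivity
      have : σ * b * z.re * (1 - z.im / (D / 2)) = b * |z.re| * (1 - z.im / (D / 2)) := by
        rw [← hσz]; ring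
      rw [this]
      nlinarith
  rcases le_total 0 z.im with h | h
  · exact aux f hf hB hdec z h (by rwa [abs_of_nonneg h] at hz)
  · have := aux (fun w => f (-w)) (hf.comp differentiable_neg.differentiableOn
        (fun w hw => by simpa [strip] using hw)) (fun w hw => hB _ (by simpa [strip] using hw))
        (fun t => by simpa using hdec (-t)) (-z) (by simpa using h)
        (by simpa [abs_of_nonpos h] using hz)
    simpa using this

/-! ### Contour shifts, tails of series and Fourier decay. -/

theorem integral_exp_neg_mul_abs {b : ℝ} (hb : 0 < b) :
    ∫ x : ℝ, Real.exp (-(b * |x|)) = 2 / b := by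
  rw [integral_comp_abs (f := fun x => Real.exp (-(b * x)))]
  have := integral_exp_mul_Ioi (neg_lt_zero.mpr hb) 0
  simp only [neg_mul] at this
  rw [this]
  simp [div_eq_mul_inv]

theorem integrable_exp_neg_mul_abs {b : ℝ} (hb : 0 < b) :
    Integrable fun x : ℝ => Real.exp (-(b * |x|)) :=
  Integrable.of_integral_ne_zero (by rw [integral_exp_neg_mul_abs hb]; positivity)

open Filter Topology Complex in
/-- Shift of the contour of integration in a horizontal strip. -/
theorem integral_comp_add_mul_I {g : ℂ → ℂ} {D y C c : ℝ} (hc : 0 < c) (hy : |y| < D)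
    (hg : DifferentiableOn ℂ g (strip D))
    (hgb : ∀ z : ℂ, |z.im| ≤ |y| → ‖g z‖ ≤ C * Real.exp (-(c * |z.re|))) :
    ∫ x : ℝ, g (x + y * I) = ∫ x : ℝ, g x := by
  have hcont : ∀ w : ℝ, |w| ≤ |y| → Continuous fun x : ℝ => g (x + w * I) := fun w hw =>
    hg.continuousOn.comp_continuous (by fun_prop) fun x => by
      simpa [strip] using hw.trans_lt hy
  have hint : ∀ w : ℝ, |w| ≤ |y| → Integrable fun x : ℝ => g (x + w * I) := fun w hw => by
    refine Integrable.mono' ((integrable_exp_neg_mul_abs hc).const_mul C)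
      (hcont w hw).aestronglyMeasurable (Eventually.of_forall fun x => ?_)
    simpa using hgb (x + w * I) (by simpa using hw)
  -- The vertical sides of the rectangle have fixed length, while the integrand on them tends to
  -- zero.
  have hv : ∀ σ : ℝ, |σ| = 1 → Tendsto (fun T : ℝ => ∫ v : ℝ in (0:ℝ)..y, g ((σ * T : ℝ) + v * I))
      atTop (𝓝 0) := by
    intro σ hσ
    have h1 : Tendsto (fun T : ℝ => C * Real.exp (-(c * T)) * |y - 0|) atTop (𝓝 0) := by
      have : Tendsto (fun T : ℝ => Real.exp (-(c * T))) atTop (𝓝 0) :=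
        Real.tendsto_exp_neg_atTop_nhds_zero.comp (tendsto_id.const_mul_atTop hc)
      simpa using (this.const_mul C).mul_const |y - 0|
    refine squeeze_zero_norm' ?_ h1
    filter_upwards [eventually_ge_atTop 0] with T hT
    refine intervalIntegral.norm_integral_le_of_norm_le_const fun v hv => ?_
    have hv' : |v| ≤ |y| := by
      have := abs_sub_left_of_mem_uIcc (uIoc_subset_uIcc hv)
      simpa using this
    have := hgb ((σ * T : ℝ) + v * I) (by simpa using hv')
    simpa [abs_mul, hσ, abs_of_nonneg hT] using this
  have hrect : ∀ T : ℝ, ((∫ x : ℝ in -T..T, g x) - ∫ x : ℝ in -T..T, g (x + y * I)) +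
      (I • (∫ v : ℝ in (0:ℝ)..y, g ((1 * T : ℝ) + v * I)) -
        I • (∫ v : ℝ in (0:ℝ)..y, g ((-1 * T : ℝ) + v * I))) = 0 := by
    intro T
    have := integral_boundary_rect_eq_zero_of_differentiableOn g (-T : ℝ) (T + y * I)
      (hg.mono fun w hw => by
        have h2 : w.im ∈ uIcc 0 y := by simpa using hw.2
        have := abs_sub_left_of_mem_uIcc h2
        simp only [sub_zero] at this
        exact this.trans_lt hy)
    rw [← add_sub_assoc]
    simpa using this
  have h1 := (intervalIntegral_tendsto_integral (hint 0 (by simp)) tendsto_neg_atTop_atBot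
    tendsto_id)
  have h2 := (intervalIntegral_tendsto_integral (hint y le_rfl) tendsto_neg_atTop_atBot
    tendsto_id)
  have h3 := (h1.sub h2).add (((hv 1 (by simp)).const_smul I).sub ((hv (-1) (by simp)).const_smul I))
  have h4 := h3.congr (fun T => by simpa using hrect T)
  have := tendsto_nhds_unique h4 tendsto_const_nhds
  simp only [smul_zero, sub_zero, add_zero, ofReal_zero, zero_mul] at this
  exact (sub_eq_zero.mp this).symm

/-- Tail of a two-sided geometrically dominated series. -/
theorem norm_tsum_int_sub_sum_Icc_le {F : ℤ → ℂ} {A c : ℝ} (hc : 0 < c)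
    (hF : ∀ n : ℤ, ‖F n‖ ≤ A * Real.exp (-(c * |(n : ℝ)|))) (N : ℕ) :
    Summable F ∧ ‖(∑' n, F n) - ∑ n ∈ Finset.Icc (-(N : ℤ)) N, F n‖ ≤
      2 * A * Real.exp (-(c * (N + 1))) / (1 - Real.exp (-c)) := by
  have hgeo : ∀ n : ℕ, Real.exp (-(c * (n : ℝ))) = Real.exp (-c) ^ n := fun n => by
    rw [← Real.exp_nat_mul]; ring_nf
  have he1 : Real.exp (-c) < 1 := by simpa using hc
  have hsum : Summable fun n : ℕ => A * Real.exp (-(c * (n : ℝ))) := by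
    simp_rw [hgeo]
    exact (summable_geometric_of_lt_one (Real.exp_pos _).le he1).mul_left A
  have hS : ∀ G : ℤ → ℂ, (∀ n : ℤ, ‖G n‖ ≤ A * Real.exp (-(c * |(n : ℝ)|))) →
      Summable (fun n : ℕ => G n) ∧ Summable (fun n : ℕ => G (-(n + 1 : ℤ))) := by
    intro G hG
    refine ⟨.of_norm_bounded hsum fun n => by simpa using hG n,
      .of_norm_bounded ((summable_nat_add_iff 1).mpr hsum) fun n => ?_⟩
    have h2 := hG (-(n + 1))
    have h3 : |((-(n + 1 : ℤ) : ℤ) : ℝ)| = ((n + 1 : ℕ) : ℝ) := by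
      push_cast
      rw [abs_neg, abs_of_nonneg (by positivity)]
    rwa [h3] at h2
  have hFs : Summable F := .of_nat_of_neg_add_one (hS F hF).1 (hS F hF).2
  refine ⟨hFs, ?_⟩
  have hA : 0 ≤ A := by simpa using (norm_nonneg _).trans (hF 0)
  set G : ℤ → ℂ := fun n => if n ∈ Finset.Icc (-(N : ℤ)) N then 0 else F n with hGdef
  have hG : ∀ n : ℤ, ‖G n‖ ≤ A * Real.exp (-(c * |(n : ℝ)|)) := fun n => by
    simp only [hGdef]
    split_ifs
    · rw [norm_zero]; positivity
    · exact hF n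
  have hdiff : (∑' n, F n) - ∑ n ∈ Finset.Icc (-(N : ℤ)) N, F n = ∑' n, G n := by
    have h1 := hFs.tsum_sub (summable_of_ne_finset_zero
      (f := fun n => if n ∈ Finset.Icc (-(N : ℤ)) N then F n else 0)
      (s := Finset.Icc (-(N : ℤ)) N) (fun n hn => by simp only [if_neg hn]))
    rw [tsum_eq_sum (s := Finset.Icc (-(N : ℤ)) N)
      (f := fun n => if n ∈ Finset.Icc (-(N : ℤ)) N then F n else 0)
      (fun n hn => by simp only [if_neg hn]), Finset.sum_ite_mem, Finset.inter_self] at h1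
    rw [← h1]
    refine tsum_congr fun n => ?_
    simp only [hGdef]
    split_ifs <;> simp
  have htail : HasSum (fun n : ℕ => A * Real.exp (-(c * (N + 1))) * Real.exp (-c) ^ n)
      (A * Real.exp (-(c * (N + 1))) * (1 - Real.exp (-c))⁻¹) :=
    (hasSum_geometric_of_lt_one (Real.exp_pos _).le he1).mul_left _
  have hexp : ∀ n : ℕ, A * Real.exp (-(c * (N + 1))) * Real.exp (-c) ^ n =
      A * Real.exp (-(c * (n + N + 1))) := fun n => by
    rw [mul_assoc, ← hgeo, ← Real.exp_add]; ring_nf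
  rw [hdiff, tsum_of_nat_of_neg_add_one (hS G hG).1 (hS G hG).2]
  have h1 : ‖∑' n : ℕ, G n‖ ≤ A * Real.exp (-(c * (N + 1))) * (1 - Real.exp (-c))⁻¹ := by
    rw [← (hS G hG).1.sum_add_tsum_nat_add (N + 1), Finset.sum_eq_zero, zero_add]
    · refine tsum_of_norm_bounded htail fun n => ?_
      rw [hexp]
      have := hG ((n + (N + 1) : ℕ) : ℤ)
      rw [Int.cast_natCast, abs_of_nonneg (by positivity)] at this
      push_cast at this ⊢
      simpa only [add_assoc] using this
    · intro n hn
      have := Finset.mem_range.mp hn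
      simp only [hGdef]
      rw [if_pos (by rw [Finset.mem_Icc]; omega)]
  have h2 : ‖∑' n : ℕ, G (-(n + 1 : ℤ))‖ ≤
      A * Real.exp (-(c * (N + 1))) * (1 - Real.exp (-c))⁻¹ := by
    -- The negative half is indexed by `-(n+1)`, so `N` terms vanish here against `N + 1` in the
    -- nonnegative half; both tails start at modulus `N + 1`.
    rw [← (hS G hG).2.sum_add_tsum_nat_add N, Finset.sum_eq_zero, zero_add]
    · refine tsum_of_norm_bounded htail fun n => ?_
      rw [hexp]
      have := hG (-(((n + N : ℕ) : ℤ) + 1))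
      rw [Int.cast_neg, abs_neg, abs_of_nonneg (by positivity)] at this
      push_cast at this ⊢
      simpa only [add_assoc] using this
    · intro n hn
      have := Finset.mem_range.mp hn
      simp only [hGdef]
      rw [if_pos (by rw [Finset.mem_Icc]; omega)]
  refine (norm_add_le _ _).trans ((add_le_add h1 h2).trans (le_of_eq ?_))
  rw [div_eq_mul_inv]; ring

theorem integrable_of_strip {f : ℂ → ℂ} {D b B : ℝ} (hD : 0 < D) (hb : 0 < b)
    (hf : DifferentiableOn ℂ f (strip D))
    (hdec : ∀ t : ℝ, ‖f t‖ ≤ B * Real.exp (-(b * |t|))) :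
    Continuous (fun t : ℝ => f t) ∧ Integrable (fun t : ℝ => f t) := by
  have hcont : Continuous fun t : ℝ => f t :=
    hf.continuousOn.comp_continuous Complex.continuous_ofReal (ofReal_mem_strip hD)
  exact ⟨hcont, ((integrable_exp_neg_mul_abs hb).const_mul B).mono' hcont.aestronglyMeasurable
    (Filter.Eventually.of_forall hdec)⟩

-- Shifting the contour by `D/4` to the side where `e^{-2πiξz}` is small gains `e^{-2π|ξ|D/4}`; the
-- remaining decay `e^{-b|x|/2}` integrates to `4/b`.
open Complex FourierTransform in
theorem norm_fourier_le_of_strip {f : ℂ → ℂ} {D b B : ℝ} (hD : 0 < D) (hb : 0 < b)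
    (hf : DifferentiableOn ℂ f (strip D)) (hB : ∀ z ∈ strip D, ‖f z‖ ≤ B)
    (hdec : ∀ t : ℝ, ‖f t‖ ≤ B * Real.exp (-(b * |t|))) (ξ : ℝ) :
    ‖𝓕 (fun t : ℝ => f t) ξ‖ ≤ 4 * B / b * Real.exp (-(Real.pi * D / 2 * |ξ|)) := by
  obtain ⟨y, hy, hyξ⟩ : ∃ y : ℝ, |y| = D / 4 ∧ ξ * y = -(D / 4 * |ξ|) := by
    rcases le_total 0 ξ with h | h
    · exact ⟨-(D / 4), by rw [abs_neg, abs_of_pos (by positivity)], by rw [abs_of_nonneg h]; ring⟩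
    · exact ⟨D / 4, by rw [abs_of_pos (by positivity)], by rw [abs_of_nonpos h]; ring⟩
  set g : ℂ → ℂ := fun z => cexp (((-(2 * Real.pi * ξ) : ℝ) : ℂ) * (z * I)) * f z with hg
  have hgn : ∀ z, ‖g z‖ = Real.exp (2 * Real.pi * (ξ * z.im)) * ‖f z‖ := fun z => by
    rw [hg]
    simp only [norm_mul, norm_exp, re_ofReal_mul, mul_I_re]
    congr 2
    ring
  have hdec' := fun z (hz : |z.im| ≤ D / 4) => norm_le_exp_of_strip hD hb hf hB hdec (z := z) hz
  have hshift := integral_comp_add_mul_I (g := g) (D := D) (y := y)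
    (C := Real.exp (2 * Real.pi * (|ξ| * (D / 4))) * B) (c := b / 2)
    (half_pos hb) (by rw [hy]; linarith) (DifferentiableOn.mul (by fun_prop) hf)
    (fun z hz => by
      rw [hy] at hz
      rw [hgn, mul_assoc _ B]
      have h1 : ξ * z.im ≤ |ξ| * (D / 4) := by
        calc ξ * z.im ≤ |ξ * z.im| := le_abs_self _
          _ = |ξ| * |z.im| := abs_mul _ _
          _ ≤ _ := by gcongr
      exact mul_le_mul (by gcongr) (hdec' z hz) (norm_nonneg _) (Real.exp_pos _).le)
  have hF : 𝓕 (fun t : ℝ => f t) ξ = ∫ x : ℝ, g x := by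
    rw [Real.fourier_real_eq_integral_exp_smul]
    refine integral_congr_ae (Filter.Eventually.of_forall fun x => ?_)
    simp only [hg, smul_eq_mul]
    congr 2
    push_cast
    ring
  rw [hF, ← hshift]
  have hbound : ∀ x : ℝ, ‖g (x + y * I)‖ ≤
      Real.exp (-(Real.pi * D / 2 * |ξ|)) * B * Real.exp (-(b / 2 * |x|)) := fun x => by
    rw [hgn]
    have h1 := hdec' (x + y * I) (by simp [hy])
    simp only [add_im, ofReal_im, mul_I_im, ofReal_re, zero_add, add_re, mul_I_re, neg_zero,
      add_zero] at h1 ⊢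
    rw [hyξ, mul_assoc _ B]
    refine mul_le_mul (le_of_eq ?_) h1 (norm_nonneg _) (Real.exp_pos _).le
    ring_nf
  refine (norm_integral_le_of_norm_le ((integrable_exp_neg_mul_abs (half_pos hb)).const_mul _)
    (Filter.Eventually.of_forall hbound)).trans (le_of_eq ?_)
  rw [integral_const_mul, integral_exp_neg_mul_abs (half_pos hb)]
  field_simp
  ring

/-! ### Trapezoidal and sinc quadrature on the line. -/

open Complex FourierTransform Filter in
/-- Exponential accuracy of the infinite trapezoidal rule with unit step. -/
theorem norm_tsum_sub_integral_le_of_strip {f : ℂ → ℂ} {D b B : ℝ} (hD : 0 < D) (hb : 0 < b)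
    (hf : DifferentiableOn ℂ f (strip D)) (hB : ∀ z ∈ strip D, ‖f z‖ ≤ B)
    (hdec : ∀ t : ℝ, ‖f t‖ ≤ B * Real.exp (-(b * |t|))) :
    ‖(∑' n : ℤ, f n) - ∫ t : ℝ, f t‖ ≤ 2 * (4 * B / b) * Real.exp (-(Real.pi * D / 2)) /
      (1 - Real.exp (-(Real.pi * D / 2))) := by
  have hB0 : 0 ≤ B := (norm_nonneg _).trans (hB 0 (by simp [strip, hD]))
  have hcont := (integrable_of_strip hD hb hf hdec).1
  have hfour := norm_fourier_le_of_strip hD hb hf hB hdec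
  -- With `N = 0` the removed window is the zero frequency alone, whose Fourier coefficient is the
  -- integral.
  obtain ⟨hs, htail⟩ := norm_tsum_int_sub_sum_Icc_le (F := fun n : ℤ => 𝓕 (fun t : ℝ => f t) n)
    (by positivity : 0 < Real.pi * D / 2) (fun n => hfour n) 0
  have hO : (fun t : ℝ => f t) =O[cocompact ℝ] fun x : ℝ => |x| ^ (-(2 : ℝ)) := by
    refine Asymptotics.IsBigO.of_bound (B * (2 / b ^ 2)) ?_
    have hne : ∀ᶠ x : ℝ in cocompact ℝ, x ≠ 0 := by
      simpa using (isCompact_singleton (x := (0 : ℝ))).compl_mem_cocompact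
    filter_upwards [hne] with x hx
    have hx' : 0 < |x| := abs_pos.mpr hx
    refine (hdec x).trans ?_
    rw [mul_assoc]
    refine mul_le_mul_of_nonneg_left ?_ hB0
    rw [Real.norm_of_nonneg (by positivity), Real.rpow_neg hx'.le, Real.exp_neg,
      Real.rpow_two, ← div_eq_mul_inv, div_div, inv_eq_one_div,
      div_le_div_iff₀ (Real.exp_pos _) (by positivity)]
    have := Real.quadratic_le_exp_of_nonneg (x := b * |x|) (by positivity)
    have h0 : 0 ≤ b * |x| := by positivity
    nlinarith
  have hP := Real.tsum_eq_tsum_fourier_of_rpow_decay_of_summable hcont one_lt_two hO hs 0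
  have h0 : 𝓕 (fun t : ℝ => f t) 0 = ∫ t : ℝ, f t := by
    rw [Real.fourier_real_eq_integral_exp_smul]
    simp
  have hP' : (∑' n : ℤ, f n) = ∑' n : ℤ, 𝓕 (fun t : ℝ => f t) n := by
    simpa using hP
  rw [hP', ← h0]
  simpa using htail

/-- Sinc quadrature for a bounded holomorphic function on a strip which decays exponentially on the
real axis. -/
theorem exists_sinc_quadrature_bound {D b C₀ : ℝ} (hD : 0 < D) (hb : 0 < b) (hC₀ : 0 < C₀) :
    ∃ C β : ℝ, 0 < C ∧ 0 < β ∧ ∀ (f : ℂ → ℂ) (B : ℝ), DifferentiableOn ℂ f (strip D) →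
      (∀ z ∈ strip D, ‖f z‖ ≤ B) → (∀ t : ℝ, ‖f t‖ ≤ B * Real.exp (-(b * |t|))) →
      ∀ M : ℕ, 1 ≤ M →
        ‖(∫ t : ℝ, f t) - ∑ k ∈ Finset.Icc (-(M : ℤ)) M,
          (step C₀ M : ℂ) * f ((k * step C₀ M : ℝ) : ℂ)‖ ≤ C * B * Real.exp (-(β * Real.sqrt M)) := by
  -- `E` is the aliasing factor at the largest possible step `h = C₀`, so `1 - E` bounds its
  -- denominator from below for every `M`.
  set E := Real.exp (-(Real.pi * D / (2 * C₀))) with hE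
  have hE1 : 0 < 1 - E := by
    have : E < 1 := by rw [hE, Real.exp_lt_one_iff]; simp only [neg_lt_zero]; positivity
    linarith
  -- The first summand of `C` and the first rate come from discretization, the second ones from
  -- truncation.
  refine ⟨8 / (b * (1 - E)) + 2 * (1 + b * C₀) / b, min (Real.pi * D / (2 * C₀)) (b * C₀),
    by positivity, by positivity, fun f B hf hB hdec M hM => ?_⟩
  have hB0 : 0 ≤ B := (norm_nonneg _).trans (hB 0 (by simp [strip, hD]))
  have hM1 : (1 : ℝ) ≤ M := by exact_mod_cast hM
  have hsM1 : 1 ≤ Real.sqrt M := by rw [Real.one_le_sqrt]; exact hM1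
  have hsM : 0 < Real.sqrt M := by linarith
  set h := step C₀ M with hh
  have hpos : 0 < h := by rw [hh, step]; positivity
  have hle : h ≤ C₀ := by rw [hh, step]; exact div_le_self hC₀.le hsM1
  have hfh : DifferentiableOn ℂ (fun z => f (h * z)) (strip (D / h)) := by
    refine hf.comp (by fun_prop) fun z hz => ?_
    simp only [strip, mem_ofPred_eq, Complex.im_ofReal_mul, abs_mul, abs_of_pos hpos] at hz ⊢
    rwa [lt_div_iff₀' hpos] at hz
  have hBh : ∀ z ∈ strip (D / h), ‖f (h * z)‖ ≤ B := fun z hz => hB _ <| by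
    simp only [strip, mem_ofPred_eq, Complex.im_ofReal_mul, abs_mul, abs_of_pos hpos] at hz ⊢
    rwa [lt_div_iff₀' hpos] at hz
  have hdh : ∀ t : ℝ, ‖f (h * t)‖ ≤ B * Real.exp (-(b * h * |t|)) := fun t => by
    have := hdec (h * t)
    rw [abs_mul, abs_of_pos hpos, ← mul_assoc] at this
    exact_mod_cast this
  have h1 := norm_tsum_sub_integral_le_of_strip (div_pos hD hpos) (mul_pos hb hpos) hfh hBh hdh
  obtain ⟨-, h2⟩ := norm_tsum_int_sub_sum_Icc_le (F := fun n : ℤ => f (h * n)) (mul_pos hb hpos)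
    (fun n => by simpa using hdh n) M
  have hscale : (∫ t : ℝ, f t) = h * ∫ t : ℝ, f (h * t) := by
    have := Measure.integral_comp_mul_left (fun t : ℝ => f t) h
    simp only [Complex.ofReal_mul] at this
    rw [this, abs_of_pos (inv_pos.mpr hpos), Complex.real_smul, ← mul_assoc, ← Complex.ofReal_mul,
      mul_inv_cancel₀ hpos.ne']
    simp
  have hsum : ∑ k ∈ Finset.Icc (-(M : ℤ)) M, (h : ℂ) * f ((k * h : ℝ) : ℂ) =
      h * ∑ k ∈ Finset.Icc (-(M : ℤ)) M, f (h * k) := by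
    rw [Finset.mul_sum]
    refine Finset.sum_congr rfl fun k _ => ?_
    push_cast
    rw [mul_comm (k : ℂ)]
  rw [hscale, hsum, ← mul_sub, norm_mul, Complex.norm_real, Real.norm_of_nonneg hpos.le]
  set β := min (Real.pi * D / (2 * C₀)) (b * C₀)
  have e1 : Real.exp (-(Real.pi * (D / h) / 2)) ≤ Real.exp (-(β * Real.sqrt M)) := by
    refine Real.exp_le_exp.mpr (neg_le_neg ?_)
    calc β * Real.sqrt M ≤ Real.pi * D / (2 * C₀) * Real.sqrt M := by
          gcongr; exact min_le_left _ _
      _ = _ := by rw [hh, step]; field_simp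
  have e2 : Real.exp (-(Real.pi * (D / h) / 2)) ≤ E := by
    refine Real.exp_le_exp.mpr (neg_le_neg ?_)
    calc Real.pi * D / (2 * C₀) ≤ Real.pi * D / (2 * h) := by gcongr
      _ = _ := by field_simp
  have e3 : Real.exp (-(b * h * (M + 1))) ≤ Real.exp (-(β * Real.sqrt M)) := by
    refine Real.exp_le_exp.mpr (neg_le_neg ?_)
    have : h * M = C₀ * Real.sqrt M := by
      rw [hh, step, div_mul_eq_mul_div, div_eq_iff hsM.ne', mul_assoc,
        Real.mul_self_sqrt (by positivity)]
    calc β * Real.sqrt M ≤ b * C₀ * Real.sqrt M := by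
          gcongr; exact min_le_right _ _
      _ = b * h * M := by rw [mul_assoc, ← this, mul_assoc]
      _ ≤ _ := by
        have : 0 ≤ b * h := by positivity
        nlinarith
  -- The truncation denominator degenerates as `h → 0`; the factor `h` in front of the sum
  -- compensates for it.
  have e4 : h / (1 - Real.exp (-(b * h))) ≤ (1 + b * C₀) / b := by
    have h5 := Real.add_one_le_exp (b * h)
    have hx : 0 < b * h := by positivity
    have h6 : Real.exp (-(b * h)) ≤ 1 / (b * h + 1) := by
      rw [Real.exp_neg, inv_eq_one_div]
      exact one_div_le_one_div_of_le (by linarith) h5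
    have h7 : b * h / (b * h + 1) ≤ 1 - Real.exp (-(b * h)) := by
      have : b * h / (b * h + 1) = 1 - 1 / (b * h + 1) := by field_simp; ring
      linarith
    calc h / (1 - Real.exp (-(b * h))) ≤ h / (b * h / (b * h + 1)) := by
          gcongr
      _ = (1 + b * h) / b := by field_simp; ring
      _ ≤ _ := by gcongr
  set X := Real.exp (-(β * Real.sqrt M))
  have hsplit : ‖(∫ t : ℝ, f (h * t)) - ∑ k ∈ Finset.Icc (-(M : ℤ)) M, f (h * k)‖ ≤
      2 * (4 * B / (b * h)) * X / (1 - E) + 2 * B * X / (1 - Real.exp (-(b * h))) := by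
    have hb1 : 0 < 1 - Real.exp (-(b * h)) := by
      have : Real.exp (-(b * h)) < 1 := by
        rw [Real.exp_lt_one_iff]; simp only [neg_lt_zero]; positivity
      linarith
    refine (norm_sub_le_norm_sub_add_norm_sub _ (∑' n : ℤ, f (h * n)) _).trans (add_le_add ?_ ?_)
    · rw [norm_sub_rev]
      refine h1.trans ?_
      gcongr
    · refine h2.trans ?_
      gcongr
  calc _ ≤ h * (2 * (4 * B / (b * h)) * X / (1 - E) + 2 * B * X / (1 - Real.exp (-(b * h)))) := by
        gcongr
    _ = 8 / (b * (1 - E)) * B * X + 2 * (h / (1 - Real.exp (-(b * h)))) * B * X := by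
        field_simp
        ring
    _ ≤ 8 / (b * (1 - E)) * B * X + 2 * ((1 + b * C₀) / b) * B * X := by
        gcongr
    _ = _ := by ring

theorem gaussSum_eq_sum_prod {d : ℕ} (w g : ℤ → ℝ) (M : ℕ) (x : EuclideanSpace ℝ (Fin d)) :
    gaussSum w g M x =
      ∑ k ∈ Finset.Icc (-(M : ℤ)) (M : ℤ), w k * ∏ l, Real.exp (-(g k * x l ^ 2)) := by
  refine Finset.sum_congr rfl fun k _ => ?_
  rw [← Real.exp_sum, EuclideanSpace.norm_sq_eq, Finset.mul_sum, Finset.sum_neg_distrib]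
  simp

/-- Sinc quadrature for Gaussian-type integrals over the line. -/
theorem exists_strip_gaussSum_bound {D b C₀ : ℝ} (hD : 0 < D) (hb : 0 < b) (hC₀ : 0 < C₀) :
    ∃ C β : ℝ, 0 < C ∧ 0 < β ∧
      ∀ (a₁ a₂ q : ℝ → ℝ) (p₀ B : ℝ), 0 < p₀ → StripWeights a₁ a₂ D b p₀ B →
        (∀ p : ℝ, p₀ ≤ p → q p = ∫ t : ℝ, a₁ t * Real.exp (-(p ^ 2 * a₂ t))) →
        (∀ p : ℝ, p₀ ≤ p → Integrable (fun t : ℝ => a₁ t * Real.exp (-(p ^ 2 * a₂ t)))) ∧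
        ∀ (d M : ℕ), 1 ≤ M → ∀ x : EuclideanSpace ℝ (Fin d), p₀ ≤ ‖x‖ →
          |q ‖x‖ - gaussSum (fun k => a₁ (k * step C₀ M) * step C₀ M)
              (fun k => a₂ (k * step C₀ M)) M x| ≤ C * B * Real.exp (-(β * Real.sqrt M)) := by
  obtain ⟨C, β, hC, hβ, H⟩ := exists_sinc_quadrature_bound hD hb hC₀
  refine ⟨C, β, hC, hβ, fun a₁ a₂ q p₀ B hp₀ hw hq => ?_⟩
  obtain ⟨A₁, A₂, hA₁, hA₂, hr₁, hr₂, hAB⟩ := hw.analytic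
  have hreal : ∀ (p t : ℝ), A₁ t * Complex.exp (-((p : ℂ) ^ 2 * A₂ t)) =
      ((a₁ t * Real.exp (-(p ^ 2 * a₂ t)) : ℝ) : ℂ) := fun p t => by
    rw [hr₁, hr₂]; push_cast; rfl
  have hdiff : ∀ p : ℝ, DifferentiableOn ℂ
      (fun z => A₁ z * Complex.exp (-((p : ℂ) ^ 2 * A₂ z))) (strip D) := fun p =>
    hA₁.mul (hA₂.const_mul _).neg.cexp
  have hdec : ∀ p : ℝ, p₀ ≤ p → ∀ t : ℝ, ‖A₁ t * Complex.exp (-((p : ℂ) ^ 2 * A₂ t))‖ ≤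
      B * Real.exp (-(b * |t|)) := fun p hp t => by
    rw [hreal, Complex.norm_real, Real.norm_of_nonneg (mul_nonneg (hw.pos₁ t).le (Real.exp_pos _).le)]
    exact hw.decay p hp t
  refine ⟨fun p hp => ?_, fun d M hM x hx => ?_⟩
  · have := (integrable_of_strip hD hb (hdiff p) (hdec p hp)).2
    simp only [hreal] at this
    exact this.re
  · have := H _ B (hdiff ‖x‖) (hAB _ hx) (hdec _ hx) M hM
    simp only [hreal] at this
    rw [integral_complex_ofReal, ← hq _ hx] at this
    refine le_trans (le_of_eq ?_) this
    rw [← Real.norm_eq_abs, ← Complex.norm_real, gaussSum]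
    push_cast
    congr 2
    refine Finset.sum_congr rfl fun k _ => ?_
    ring_nf

/-! ### The substitution `t = e^u/a₀`: half-line to line, sector to strip. -/

theorem range_exp_div {a₀ : ℝ} (ha₀ : 0 < a₀) :
    (fun u : ℝ => Real.exp u / a₀) '' univ = Ioi 0 := by
  ext t
  simp only [image_univ, mem_range, mem_Ioi]
  refine ⟨?_, fun ht => ⟨Real.log (t * a₀), ?_⟩⟩
  · rintro ⟨u, rfl⟩
    positivity
  · rw [Real.exp_log (by positivity)]
    field_simp

theorem exp_div_hasDerivWithinAt (a₀ : ℝ) (u : ℝ) :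
    HasDerivWithinAt (fun u : ℝ => Real.exp u / a₀) (Real.exp u / a₀) univ u :=
  ((Real.hasDerivAt_exp u).div_const a₀).hasDerivWithinAt

theorem exp_div_injOn {a₀ : ℝ} (ha₀ : 0 < a₀) :
    InjOn (fun u : ℝ => Real.exp u / a₀) univ := fun _ _ _ _ h =>
  Real.exp_injective ((div_left_inj' ha₀.ne').mp h)

theorem integral_Ioi_eq_integral_exp_div {E : Type*} [NormedAddCommGroup E] [NormedSpace ℝ E]
    {a₀ : ℝ} (ha₀ : 0 < a₀) (g : ℝ → E) :
    ∫ t in Ioi 0, g t = ∫ u : ℝ, (Real.exp u / a₀) • g (Real.exp u / a₀) := by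
  rw [← range_exp_div ha₀, integral_image_eq_integral_abs_deriv_smul MeasurableSet.univ
    (fun u _ => exp_div_hasDerivWithinAt a₀ u) (exp_div_injOn ha₀), Measure.restrict_univ]
  simp_rw [abs_of_pos (div_pos (Real.exp_pos _) ha₀)]

theorem integrableOn_Ioi_iff_exp_div {E : Type*} [NormedAddCommGroup E] [NormedSpace ℝ E]
    {a₀ : ℝ} (ha₀ : 0 < a₀) (g : ℝ → E) :
    IntegrableOn g (Ioi 0) ↔
      Integrable fun u : ℝ => (Real.exp u / a₀) • g (Real.exp u / a₀) := by
  rw [← range_exp_div ha₀, integrableOn_image_iff_integrableOn_abs_deriv_smul MeasurableSet.univ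
    (fun u _ => exp_div_hasDerivWithinAt a₀ u) (exp_div_injOn ha₀), integrableOn_univ]
  simp_rw [abs_of_pos (div_pos (Real.exp_pos _) ha₀)]

theorem exp_div_mem_sector {a₀ D : ℝ} (ha₀ : 0 < a₀) (hD : D ≤ Real.pi) {u : ℂ}
    (hu : u ∈ strip D) : Complex.exp u / a₀ ∈ sector D := by
  have hu' : |u.im| < D := hu
  have h0 : (a₀ : ℂ) ≠ 0 := by exact_mod_cast ha₀.ne'
  refine ⟨div_ne_zero (Complex.exp_ne_zero _) h0, ?_⟩
  have h1 : Complex.exp u / a₀ = ((a₀⁻¹ : ℝ) : ℂ) * Complex.exp u := by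
    push_cast; rw [div_eq_inv_mul]
  have h2 := abs_lt.mp (hu'.trans_le hD)
  rw [h1, Complex.arg_real_mul _ (inv_pos.mpr ha₀), Complex.arg_exp,
    (toIocMod_eq_self Real.two_pi_pos).mpr ⟨by linarith, by linarith⟩]
  exact hu

theorem norm_exp_div {a₀ : ℝ} (ha₀ : 0 < a₀) (u : ℂ) :
    ‖Complex.exp u / a₀‖ = Real.exp u.re / a₀ := by
  rw [norm_div, Complex.norm_exp, Complex.norm_real, Real.norm_of_nonneg ha₀.le]

/-- Sinc quadrature on the half-line, for functions holomorphic in a sector. -/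
theorem exists_sector_quadrature_bound {D b C₀ : ℝ} (hD : 0 < D) (hDπ : D ≤ Real.pi) (hb : 0 < b)
    (hC₀ : 0 < C₀) :
    ∃ C β : ℝ, 0 < C ∧ 0 < β ∧ ∀ (F : ℂ → ℂ) (φ : ℝ → ℝ) (a₀ B : ℝ), 0 < a₀ →
      DifferentiableOn ℂ F (sector D) → (∀ t : ℝ, 0 < t → F t = φ t) →
      (∀ w ∈ sector D, ‖w‖ * ‖F w‖ ≤ B * Real.exp (-(b * |Real.log (a₀ * ‖w‖)|))) →
      IntegrableOn φ (Ioi 0) ∧ ∀ M : ℕ, 1 ≤ M →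
        |(∫ t in Ioi 0, φ t) - ∑ k ∈ Finset.Icc (-(M : ℤ)) M, weight φ a₀ (step C₀ M) k|
          ≤ C * B * Real.exp (-(β * Real.sqrt M)) := by
  obtain ⟨C, β, hC, hβ, H⟩ := exists_sinc_quadrature_bound hD hb hC₀
  refine ⟨C, β, hC, hβ, fun F φ a₀ B ha₀ hF hφ hFb => ?_⟩
  -- The Jacobian `e^u/a₀` is part of `f`. Since `a₀‖w‖ = e^{Re u}` for `w = e^u/a₀`, the hypothesis
  -- on `F` is exactly exponential decay in `Re u`, valid in the whole strip.
  set f : ℂ → ℂ := fun u => Complex.exp u / a₀ * F (Complex.exp u / a₀) with hf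
  have hfd : DifferentiableOn ℂ f (strip D) := by
    have h1 : DifferentiableOn ℂ (fun u => Complex.exp u / (a₀ : ℂ)) (strip D) := by fun_prop
    exact h1.mul (hF.comp h1 fun u hu => exp_div_mem_sector ha₀ hDπ hu)
  have hfb : ∀ u ∈ strip D, ‖f u‖ ≤ B * Real.exp (-(b * |u.re|)) := fun u hu => by
    have := hFb _ (exp_div_mem_sector ha₀ hDπ hu)
    rw [← norm_mul, norm_exp_div ha₀, mul_div_cancel₀ _ ha₀.ne', Real.log_exp] at this
    exact this
  have hB : 0 ≤ B := by simpa using (norm_nonneg _).trans (hfb 0 (by simp [strip, hD]))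
  have hreal : ∀ u : ℝ, f u = ((Real.exp u / a₀ * φ (Real.exp u / a₀) : ℝ) : ℂ) := fun u => by
    have h2 : Complex.exp u / a₀ = ((Real.exp u / a₀ : ℝ) : ℂ) := by push_cast; rfl
    simp only [hf]
    rw [h2, hφ _ (by positivity)]
    push_cast; rfl
  have hdec : ∀ t : ℝ, ‖f t‖ ≤ B * Real.exp (-(b * |t|)) := fun t => by
    simpa using hfb t (ofReal_mem_strip hD t)
  refine ⟨?_, fun M hM => ?_⟩
  · rw [integrableOn_Ioi_iff_exp_div ha₀]
    have := (integrable_of_strip hD hb hfd hdec).2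
    simp only [hreal] at this
    exact this.re
  · have := H f B hfd (fun u hu => (hfb u hu).trans
      (mul_le_of_le_one_right hB (by
        rw [Real.exp_le_one_iff, neg_nonpos]; positivity))) hdec M hM
    simp only [hreal] at this
    rw [integral_complex_ofReal] at this
    rw [integral_Ioi_eq_integral_exp_div ha₀]
    refine le_trans (le_of_eq ?_) this
    rw [← Real.norm_eq_abs, ← Complex.norm_real]
    push_cast
    congr 2
    refine Finset.sum_congr rfl fun k _ => ?_
    simp only [weight, node]
    push_cast
    ring

/-! ### Gaussian bounds in a sector and Laplace–Gauss transforms. -/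

/-- After `log y ≤ y` the exponent is the quadratic `n y - c y²`, with maximum `n²/(4c)`. -/
theorem rpow_mul_exp_neg_mul_sq_le {y n c : ℝ} (hy : 0 < y) (hn : 0 ≤ n) (hc : 0 < c) :
    y ^ n * Real.exp (-(c * y ^ 2)) ≤ Real.exp (n ^ 2 / (4 * c)) := by
  rw [Real.rpow_def_of_pos hy, ← Real.exp_add, Real.exp_le_exp]
  have h1 : Real.log y ≤ y := (Real.log_le_sub_one_of_pos hy).trans (by linarith)
  have h2 : Real.log y * n ≤ y * n := by gcongr
  have h3 : 0 ≤ (2 * c * y - n) ^ 2 / (4 * c) := by positivity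
  have h4 : (2 * c * y - n) ^ 2 / (4 * c) = c * y ^ 2 - y * n + n ^ 2 / (4 * c) := by
    field_simp; ring
  linarith

/-- Squaring doubles the angle, which stays below `π/3`, where the cosine is at least `1/2`. This is
the reason for cutting every sector down to half-angle `π/6`. -/
theorem half_sq_norm_le_re_sq {w : ℂ} {D : ℝ} (hD : D ≤ Real.pi / 6) (hw : w ∈ sector D) :
    ‖w‖ ^ 2 / 2 ≤ (w ^ 2).re := by
  have h1 : |w.arg| < Real.pi / 6 := hw.2.trans_le hD
  have hpi := Real.pi_pos
  have h2 : Real.cos (Real.pi / 3) ≤ Real.cos (2 * w.arg) := by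
    rw [← Real.cos_abs (2 * w.arg), abs_mul, abs_two]
    exact Real.cos_le_cos_of_nonneg_of_le_pi (by positivity) (by linarith) (by linarith)
  have h3 : w ^ 2 = ((‖w‖ ^ 2 : ℝ) : ℂ) * Complex.exp ((2 * w.arg : ℝ) * Complex.I) := by
    conv_lhs => rw [← Complex.norm_mul_exp_arg_mul_I w]
    rw [mul_pow, ← Complex.exp_nat_mul]
    push_cast
    ring_nf
  rw [h3, Complex.re_ofReal_mul, Complex.exp_ofReal_mul_I_re]
  rw [Real.cos_pi_div_three] at h2
  have := mul_le_mul_of_nonneg_left h2 (sq_nonneg ‖w‖)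
  linarith

theorem norm_exp_neg_sq_mul_sq_le {w : ℂ} {D : ℝ} (hD : D ≤ Real.pi / 6) (hw : w ∈ sector D)
    (y : ℝ) : ‖Complex.exp (-(w ^ 2 * (y : ℂ) ^ 2))‖ ≤ Real.exp (-(‖w‖ ^ 2 / 2 * y ^ 2)) := by
  rw [Complex.norm_exp, Complex.neg_re, ← Complex.ofReal_pow, Complex.re_mul_ofReal]
  gcongr
  exact half_sq_norm_le_re_sq hD hw

theorem sector_mono {D δ : ℝ} (h : D ≤ δ) : sector D ⊆ sector δ := fun _ hw =>
  ⟨hw.1, hw.2.trans_le h⟩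

theorem ofReal_mem_sector {δ t : ℝ} (hδ : 0 < δ) (ht : 0 < t) : (t : ℂ) ∈ sector δ :=
  ⟨by exact_mod_cast ht.ne', by rwa [Complex.arg_ofReal_of_nonneg ht.le, abs_zero]⟩

theorem SectorWeight.nonneg {a : ℝ → ℝ} {δ s m K : ℝ} (h : SectorWeight a δ s m K) (hδ : 0 < δ) :
    0 ≤ K := by
  obtain ⟨A, -, -, hA⟩ := h.analytic
  have h1 := (norm_nonneg _).trans (hA 1 (by simpa using ofReal_mem_sector hδ one_pos))
  rw [norm_one, Real.one_rpow, mul_one] at h1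
  exact nonneg_of_mul_nonneg_left h1 (by positivity)

/-- The growth of a Laplace–Gauss integrand in logarithmic coordinates. -/
theorem rpow_mul_one_add_rpow_mul_exp_le {s m y : ℝ} (hs : 0 < s) (hm : 0 ≤ m) (hy : 0 < y) :
    y ^ s * (1 + y) ^ m * Real.exp (-(y ^ 2 / 2)) ≤
      2 ^ m * Real.exp ((2 * s + m) ^ 2 / 2) * Real.exp (-(s * |Real.log y|)) := by
  rcases le_total y 1 with h | h
  · rw [abs_of_nonpos (Real.log_nonpos hy.le h)]
    have h1 : Real.exp (-(s * -Real.log y)) = y ^ s := by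
      rw [Real.rpow_def_of_pos hy]; ring_nf
    rw [h1]
    have h2 : (1 + y) ^ m ≤ 2 ^ m := Real.rpow_le_rpow (by positivity) (by linarith) hm
    have h3 : Real.exp (-(y ^ 2 / 2)) ≤ 1 := by
      rw [Real.exp_le_one_iff, neg_nonpos]; positivity
    have h4 : 1 ≤ Real.exp ((2 * s + m) ^ 2 / 2) := Real.one_le_exp (by positivity)
    calc y ^ s * (1 + y) ^ m * Real.exp (-(y ^ 2 / 2)) ≤ y ^ s * 2 ^ m * 1 := by gcongr
      _ = 2 ^ m * 1 * y ^ s := by ring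
      _ ≤ _ := by gcongr
  · rw [abs_of_nonneg (Real.log_nonneg h)]
    have h1 : Real.exp (-(s * Real.log y)) = y ^ (-s) := by
      rw [Real.rpow_def_of_pos hy]; ring_nf
    rw [h1]
    have h2 : (1 + y) ^ m ≤ (2 * y) ^ m := Real.rpow_le_rpow (by positivity) (by linarith) hm
    -- The exponent `2s + m` is the growth `s + m` plus a further `s` that pays for the target
    -- `y^{-s}`.
    have h3 := rpow_mul_exp_neg_mul_sq_le (n := 2 * s + m) hy (by positivity) (half_pos one_pos)
    calc y ^ s * (1 + y) ^ m * Real.exp (-(y ^ 2 / 2))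
        ≤ y ^ s * (2 * y) ^ m * Real.exp (-(y ^ 2 / 2)) := by gcongr
      _ = 2 ^ m * (y ^ (2 * s + m) * Real.exp (-(1 / 2 * y ^ 2))) * y ^ (-s) := by
        rw [Real.mul_rpow zero_le_two hy.le,
          show y ^ (2 * s + m) = y ^ s * y ^ s * y ^ m by
            rw [← Real.rpow_add hy, ← Real.rpow_add hy]; ring_nf,
          Real.rpow_neg hy.le]
        have : y ^ s ≠ 0 := (Real.rpow_pos_of_pos hy _).ne'
        field_simp
      _ ≤ 2 ^ m * Real.exp ((2 * s + m) ^ 2 / (4 * (1 / 2))) * y ^ (-s) := by gcongr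
      _ = _ := by norm_num

theorem one_add_div_le {y a₀ : ℝ} (hy : 0 < y) (ha₀ : 0 < a₀) :
    1 + y / a₀ ≤ (1 + 1 / a₀) * (1 + y) := by
  have h1 : (1 + 1 / a₀) * (1 + y) = 1 + y / a₀ + (y + 1 / a₀) := by ring
  have : 0 < y + 1 / a₀ := by positivity
  linarith

/-- Sinc quadrature for Laplace–Gauss transforms. -/
theorem exists_laplaceGauss_gaussSum_bound {δ s m C₀ : ℝ} (hδ : 0 < δ) (hs : 0 < s) (hm : 0 ≤ m)
    (hC₀ : 0 < C₀) :
    ∃ C β : ℝ, 0 < C ∧ 0 < β ∧ ∀ (a q : ℝ → ℝ) (K : ℝ), SectorWeight a δ s m K →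
      IsLaplaceGauss a q → ∀ a₀ : ℝ, 0 < a₀ → ∀ (d M : ℕ), 1 ≤ M →
        ∀ x : EuclideanSpace ℝ (Fin d), a₀ ≤ ‖x‖ →
          |q ‖x‖ - gaussSum (weight a a₀ (step C₀ M)) (fun k => node a₀ (step C₀ M) k ^ 2) M x|
            ≤ C * K * a₀ ^ (-s) * (1 + 1 / a₀) ^ m * Real.exp (-(β * Real.sqrt M)) := by
  have hpi := Real.pi_pos
  set D := min δ (Real.pi / 6) with hDdef
  have hD6 : D ≤ Real.pi / 6 := min_le_right _ _
  obtain ⟨C, β, hC, hβ, H⟩ := exists_sector_quadrature_bound (D := D) (b := s)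
    (by rw [hDdef]; positivity) (by linarith) hs hC₀
  refine ⟨C * (2 ^ m * Real.exp ((2 * s + m) ^ 2 / 2)), β, by positivity, hβ,
    fun a q K ha hq a₀ ha₀ d M hM x hx => ?_⟩
  have hK := ha.nonneg hδ
  obtain ⟨A, hA, hAr, hAb⟩ := ha.analytic
  have hp : 0 < ‖x‖ := ha₀.trans_le hx
  have hsub : sector D ⊆ sector δ := sector_mono (min_le_left _ _)
  have key := (H (fun z => A z * Complex.exp (-(z ^ 2 * (‖x‖ : ℂ) ^ 2)))
    (fun t => a t * Real.exp (-(t ^ 2 * ‖x‖ ^ 2))) a₀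
    (2 ^ m * Real.exp ((2 * s + m) ^ 2 / 2) * (K * a₀ ^ (-s) * (1 + 1 / a₀) ^ m)) ha₀
    ((hA.mono hsub).mul (by fun_prop)) (fun t ht => by rw [hAr t ht]; push_cast; rfl)
    (fun w hw => ?_)).2 M hM
  · rw [← (hq _ hp).2] at key
    refine le_trans (le_of_eq ?_) (key.trans (le_of_eq ?_))
    · simp only [gaussSum, weight]
      congr 2
      refine Finset.sum_congr rfl fun k _ => ?_
      ring
    · ring
  · set r := ‖w‖ with hr
    have hr0 : 0 < r := norm_pos_iff.mpr hw.1
    have hy0 : 0 < a₀ * r := by positivity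
    have h1 := hAb w (hsub hw)
    have h2 := norm_exp_neg_sq_mul_sq_le hD6 hw ‖x‖
    -- From `‖x‖ ≥ a₀` the bound depends only on `y = a₀ r`. Rewriting the growth of `a` in `y`
    -- produces the factors `(1 + 1/a₀)^m` (`h4`) and `a₀^{-s}` (`h5`).
    have h3 : Real.exp (-(‖w‖ ^ 2 / 2 * ‖x‖ ^ 2)) ≤ Real.exp (-((a₀ * r) ^ 2 / 2)) := by
      refine Real.exp_le_exp.mpr (neg_le_neg ?_)
      calc (a₀ * r) ^ 2 / 2 = r ^ 2 / 2 * a₀ ^ 2 := by ring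
        _ ≤ _ := by rw [← hr]; gcongr
    have h4 : 1 + r ≤ (1 + 1 / a₀) * (1 + a₀ * r) := by
      have := one_add_div_le hy0 ha₀
      rwa [mul_div_cancel_left₀ _ ha₀.ne'] at this
    have h5 : r * r ^ (s - 1) = a₀ ^ (-s) * (a₀ * r) ^ s := by
      rw [Real.mul_rpow ha₀.le hr0.le, Real.rpow_neg ha₀.le, inv_mul_cancel_left₀
        (Real.rpow_pos_of_pos ha₀ _).ne', Real.rpow_sub_one hr0.ne', mul_div_cancel₀ _ hr0.ne']
    rw [norm_mul]
    calc r * (‖A w‖ * ‖Complex.exp (-(w ^ 2 * (‖x‖ : ℂ) ^ 2))‖)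
        ≤ r * ((K * r ^ (s - 1) * ((1 + 1 / a₀) * (1 + a₀ * r)) ^ m) *
            Real.exp (-((a₀ * r) ^ 2 / 2))) := by
          refine mul_le_mul_of_nonneg_left (mul_le_mul (h1.trans ?_) (h2.trans h3)
            (norm_nonneg _) (by positivity)) hr0.le
          gcongr
      _ = K * a₀ ^ (-s) * (1 + 1 / a₀) ^ m *
          ((a₀ * r) ^ s * (1 + a₀ * r) ^ m * Real.exp (-((a₀ * r) ^ 2 / 2))) := by
          rw [Real.mul_rpow (by positivity) (by positivity)]
          linear_combination (K * (1 + 1 / a₀) ^ m * (1 + a₀ * r) ^ m *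
            Real.exp (-((a₀ * r) ^ 2 / 2))) * h5
      _ ≤ K * a₀ ^ (-s) * (1 + 1 / a₀) ^ m * (2 ^ m * Real.exp ((2 * s + m) ^ 2 / 2) *
            Real.exp (-(s * |Real.log (a₀ * r)|))) := by
          exact mul_le_mul_of_nonneg_left (rpow_mul_one_add_rpow_mul_exp_le hs hm hy0)
            (by positivity)
      _ = _ := by ring

/-! ### Canonical and Tucker formats -/

theorem exists_norm_eq_one_smul_eq {E : Type*} [NormedAddCommGroup E] [NormedSpace ℝ E]
    [Nontrivial E] (v : E) : ∃ u : E, ‖u‖ = 1 ∧ ‖v‖ • u = v := by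
  rcases eq_or_ne v 0 with rfl | hv
  · obtain ⟨u, hu⟩ := exists_norm_eq E zero_le_one
    exact ⟨u, hu, by simp⟩
  · have : ‖v‖ ≠ 0 := norm_ne_zero_iff.mpr hv
    exact ⟨‖v‖⁻¹ • v, by rw [norm_smul, norm_inv, norm_norm, inv_mul_cancel₀ this],
      smul_inv_smul₀ this v⟩

/-- Normalizing the skeleton vectors moves `‖v k‖ ^ d` into the coefficients. The condition `1 ≤ n`
provides a unit vector to stand in for a zero `v k`. -/
theorem hasCPForm_of_eq_sum_prod {d n R : ℕ} (hn : 1 ≤ n) {A : (Fin d → Fin n) → ℝ}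
    (v : Fin R → EuclideanSpace ℝ (Fin n)) (hA : ∀ i, A i = ∑ k, ∏ l, v k (i l)) :
    HasCPForm A R := by
  have : Nonempty (Fin n) := ⟨⟨0, hn⟩⟩
  choose u hu huv using fun k => exists_norm_eq_one_smul_eq (v k)
  refine ⟨fun k => ‖v k‖ ^ d, fun _ k => u k, fun _ k => hu k, fun i => ?_⟩
  rw [hA]
  refine Finset.sum_congr rfl fun k _ => ?_
  have h : ∀ j, v k j = ‖v k‖ * u k j := fun j => by
    conv_lhs => rw [← huv k]
    simp
  simp_rw [h, Finset.prod_mul_distrib, Finset.prod_const, Finset.card_univ, Fintype.card_fin]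

/-- The same vectors occur in every direction, so one orthonormal basis of their span serves all `d`
factors; multilinear expansion of the products gives the core. -/
theorem hasTuckerForm_of_eq_sum_prod {d n R : ℕ} {A : (Fin d → Fin n) → ℝ}
    (v : Fin R → EuclideanSpace ℝ (Fin n)) (hA : ∀ i, A i = ∑ k, ∏ l, v k (i l)) :
    ∃ r : Fin d → ℕ, (∀ l, r l ≤ R) ∧ HasTuckerForm A r := by
  set V := Submodule.span ℝ (Set.range v)
  have hr : Module.finrank ℝ V ≤ R := by
    exact (finrank_range_le_card (R := ℝ) v).trans_eq (Fintype.card_fin R)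
  set r := Module.finrank ℝ V
  set e : OrthonormalBasis (Fin r) ℝ V := stdOrthonormalBasis ℝ V
  have hv : ∀ k j, v k j =
      ∑ ν, e.repr ⟨v k, Submodule.subset_span ⟨k, rfl⟩⟩ ν * (e ν : EuclideanSpace ℝ (Fin n)) j := by
    intro k j
    have h := congrArg (fun x : V => (x : EuclideanSpace ℝ (Fin n)) j)
      (e.sum_repr ⟨v k, Submodule.subset_span ⟨k, rfl⟩⟩)
    simp only at h
    rw [← h]
    simp
  refine ⟨fun _ => r, fun _ => hr,
    fun ν => ∑ k, ∏ l, e.repr ⟨v k, Submodule.subset_span ⟨k, rfl⟩⟩ (ν l),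
    fun _ ν => e ν, fun _ => e.orthonormal.comp_linearIsometry V.subtypeₗᵢ, fun i => ?_⟩
  rw [hA]
  simp_rw [hv, Finset.prod_univ_sum, Fintype.piFinset_univ, Finset.prod_mul_distrib,
    Finset.sum_mul]
  exact Finset.sum_comm

/-- The quantifier over `g` lets a single relabelling serve all multi-indices at once. -/
theorem exists_sum_Icc_eq_sum_fin {E : Type*} (M : ℕ) (v : ℤ → E) :
    ∃ w : Fin (2 * M + 1) → E, ∀ g : E → ℝ,
      ∑ k ∈ Finset.Icc (-(M : ℤ)) M, g (v k) = ∑ k, g (w k) := by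
  have hcard : (Finset.Icc (-(M : ℤ)) M).card = 2 * M + 1 := by
    rw [Int.card_Icc]; omega
  set e := (Finset.equivFinOfCardEq hcard).symm
  refine ⟨fun k => v (e k), fun g => ?_⟩
  rw [← Finset.sum_coe_sort]
  exact (e.sum_comp fun x => g (v x)).symm

/-! ### The one-dimensional Gaussian integrals -/

/-- The holomorphic extension of `gaussVec` to complex parameters. -/
noncomputable def gaussVecC (b : ℝ) (n : ℕ) (z : ℂ) (j : Fin n) : ℂ :=
  ∫ y in (-b + (j : ℝ) * (2 * b / n))..(-b + ((j : ℝ) + 1) * (2 * b / n)),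
    Complex.exp (-(z ^ 2 * (y : ℂ) ^ 2))

theorem integral_psi₁_mul {b : ℝ} {n : ℕ} (hb : 0 < b) (j : Fin n) (g : ℝ → ℝ) :
    ∫ y : ℝ, psi₁ b n j y * g y =
      ∫ y in (-b + (j : ℝ) * (2 * b / n))..(-b + ((j : ℝ) + 1) * (2 * b / n)), g y := by
  have h : (fun y => psi₁ b n j y * g y) =
      indicator (Ico (-b + (j : ℝ) * (2 * b / n)) (-b + ((j : ℝ) + 1) * (2 * b / n))) g := by
    ext y
    simp only [psi₁, indicator_apply]
    split_ifs <;> simp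
  have hle : -b + (j : ℝ) * (2 * b / n) ≤ -b + ((j : ℝ) + 1) * (2 * b / n) := by
    gcongr; linarith
  rw [h, integral_indicator measurableSet_Ico, integral_Ico_eq_integral_Ioc,
    intervalIntegral.integral_of_le hle]

theorem gaussVecC_ofReal {b : ℝ} {n : ℕ} (hb : 0 < b) (τ : ℝ) (j : Fin n) :
    gaussVecC b n τ j = gaussVec b n τ j := by
  rw [gaussVec, integral_psi₁_mul hb, gaussVecC, ← intervalIntegral.integral_ofReal]
  push_cast
  rfl

theorem differentiable_gaussVecC (b : ℝ) (n : ℕ) (j : Fin n) :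
    Differentiable ℂ fun z => gaussVecC b n z j := by
  intro z₀
  set u := -b + (j : ℝ) * (2 * b / n)
  set v := -b + ((j : ℝ) + 1) * (2 * b / n)
  have hF' : Continuous fun p : ℂ × ℝ =>
      Complex.exp (-(p.1 ^ 2 * (p.2 : ℂ) ^ 2)) * -(2 * p.1 * (p.2 : ℂ) ^ 2) := by fun_prop
  obtain ⟨C, hC⟩ := ((isCompact_closedBall z₀ 1).prod
    (isCompact_uIcc (a := u) (b := v))).exists_bound_of_continuousOn hF'.continuousOn
  refine (intervalIntegral.hasDerivAt_integral_of_dominated_loc_of_deriv_le (μ := volume)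
    (F := fun (z : ℂ) (y : ℝ) => Complex.exp (-(z ^ 2 * (y : ℂ) ^ 2)))
    (F' := fun (z : ℂ) (y : ℝ) =>
      Complex.exp (-(z ^ 2 * (y : ℂ) ^ 2)) * -(2 * z * (y : ℂ) ^ 2))
    (bound := fun _ => C) (Metric.closedBall_mem_nhds z₀ one_pos) ?_ ?_ ?_ ?_ ?_ ?_).2.differentiableAt
  · exact Filter.Eventually.of_forall fun z => Continuous.aestronglyMeasurable (by fun_prop)
  · exact Continuous.intervalIntegrable (by fun_prop) _ _
  · exact Continuous.aestronglyMeasurable (by fun_prop)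
  · exact Filter.Eventually.of_forall fun y hy z hz => hC (z, y) ⟨hz, uIoc_subset_uIcc hy⟩
  · exact intervalIntegrable_const
  · refine Filter.Eventually.of_forall fun y _ z _ => ?_
    have h1 : HasDerivAt (fun z : ℂ => -(z ^ 2 * (y : ℂ) ^ 2)) (-(2 * z * (y : ℂ) ^ 2)) z := by
      simpa using ((hasDerivAt_pow 2 z).mul_const ((y : ℂ) ^ 2)).fun_neg
    exact h1.cexp

/-- The first bound controls small `‖w‖`, the second, from extending the integral to all of `ℝ`,
controls large `‖w‖`. Neither depends on `n` or `j`, so the tensor estimate is uniform in the grid.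
-/
theorem norm_gaussVecC_le {b D : ℝ} {n : ℕ} (hb : 0 < b) (hn : 1 ≤ n) (hD : D ≤ Real.pi / 6) {w : ℂ}
    (hw : w ∈ sector D) (j : Fin n) :
    ‖gaussVecC b n w j‖ ≤ 2 * b ∧ ‖gaussVecC b n w j‖ ≤ Real.sqrt (2 * Real.pi) / ‖w‖ := by
  have hr : 0 < ‖w‖ := norm_pos_iff.mpr hw.1
  have hn' : (1 : ℝ) ≤ n := by exact_mod_cast hn
  have hle : -b + (j : ℝ) * (2 * b / n) ≤ -b + ((j : ℝ) + 1) * (2 * b / n) := by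
    gcongr; linarith
  have h1 : ‖gaussVecC b n w j‖ ≤ ∫ y in (-b + (j : ℝ) * (2 * b / n))..(-b + ((j : ℝ) + 1) *
      (2 * b / n)), Real.exp (-(‖w‖ ^ 2 / 2 * y ^ 2)) :=
    intervalIntegral.norm_integral_le_of_norm_le hle
      (Filter.Eventually.of_forall fun y _ => norm_exp_neg_sq_mul_sq_le hD hw y)
      (Continuous.intervalIntegrable (by fun_prop) _ _)
  constructor
  · refine (intervalIntegral.norm_integral_le_of_norm_le_const (C := 1) fun y _ =>
      (norm_exp_neg_sq_mul_sq_le hD hw y).trans ?_).trans ?_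
    · rw [Real.exp_le_one_iff, neg_nonpos]; positivity
    · rw [one_mul, abs_of_nonneg (by linarith)]
      calc _ = 2 * b / n := by ring
        _ ≤ 2 * b := div_le_self (by positivity) hn'
  · have hint := integrable_exp_neg_mul_sq (show 0 < ‖w‖ ^ 2 / 2 by positivity)
    have hg := integral_gaussian (‖w‖ ^ 2 / 2)
    simp only [neg_mul] at hint hg
    refine h1.trans ?_
    rw [intervalIntegral.integral_of_le hle]
    refine (setIntegral_le_integral hint
      (Filter.Eventually.of_forall fun y => (Real.exp_pos _).le)).trans (le_of_eq ?_)
    rw [hg, show Real.pi / (‖w‖ ^ 2 / 2) = 2 * Real.pi / ‖w‖ ^ 2 by field_simp,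
      Real.sqrt_div (by positivity), Real.sqrt_sq hr.le]

theorem gaussVec_pos {b : ℝ} {n : ℕ} (hb : 0 < b) (hn : 1 ≤ n) (τ : ℝ) (j : Fin n) :
    0 < gaussVec b n τ j := by
  have hn' : (0 : ℝ) < n := by exact_mod_cast hn
  rw [gaussVec, integral_psi₁_mul hb]
  refine intervalIntegral.intervalIntegral_pos_of_pos
    (Continuous.intervalIntegrable (by fun_prop) _ _) (fun y => Real.exp_pos _) ?_
  have : 0 < 2 * b / n := by positivity
  linarith

/-! ### The discretized kernel -/

theorem measurable_psi {d : ℕ} (b : ℝ) (n : ℕ) (i : Fin d → Fin n) :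
    Measurable (psi b n i) := by
  have h : ∀ j : Fin n, Measurable (psi₁ b n j) := fun j =>
    measurable_one.indicator measurableSet_Ico
  unfold psi
  exact Finset.measurable_prod _ fun l _ => (h _).comp (by fun_prop)

theorem psi₁_nonneg (b : ℝ) (n : ℕ) (j : Fin n) (y : ℝ) : 0 ≤ psi₁ b n j y :=
  indicator_nonneg (fun _ _ => zero_le_one) _

theorem psi_nonneg {d : ℕ} (b : ℝ) (n : ℕ) (i : Fin d → Fin n) (x : EuclideanSpace ℝ (Fin d)) :
    0 ≤ psi b n i x := Finset.prod_nonneg fun _ _ => psi₁_nonneg _ _ _ _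

theorem psi_mul_exp_eq {d : ℕ} (b : ℝ) (n : ℕ) (i : Fin d → Fin n) (t : ℝ)
    (x : EuclideanSpace ℝ (Fin d)) :
    psi b n i x * Real.exp (-(t ^ 2 * ‖x‖ ^ 2)) =
      ∏ l, psi₁ b n (i l) (x l) * Real.exp (-(t ^ 2 * x l ^ 2)) := by
  rw [Finset.prod_mul_distrib, ← Real.exp_sum, EuclideanSpace.norm_sq_eq, Finset.mul_sum,
    Finset.sum_neg_distrib, psi]
  simp

theorem integrable_psi₁_mul {b : ℝ} {n : ℕ} (j : Fin n) {g : ℝ → ℝ} (hg : Continuous g) :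
    Integrable fun y => psi₁ b n j y * g y := by
  have h : (fun y => psi₁ b n j y * g y) =
      indicator (Ico (-b + (j : ℝ) * (2 * b / n)) (-b + ((j : ℝ) + 1) * (2 * b / n))) g := by
    ext y
    simp only [psi₁, indicator_apply]
    split_ifs <;> simp
  rw [h, integrable_indicator_iff measurableSet_Ico]
  exact (hg.integrableOn_Icc).mono_set Ico_subset_Icc_self

theorem integrable_psi_mul_exp {d : ℕ} (b : ℝ) (n : ℕ) (i : Fin d → Fin n) (t : ℝ) :
    Integrable fun x : EuclideanSpace ℝ (Fin d) =>
      psi b n i x * Real.exp (-(t ^ 2 * ‖x‖ ^ 2)) := by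
  simp_rw [psi_mul_exp_eq]
  rw [← (PiLp.volume_preserving_toLp (Fin d)).integrable_comp_emb
    (MeasurableEquiv.toLp 2 _).measurableEmbedding]
  exact Integrable.fintype_prod (f := fun l y => psi₁ b n (i l) y * Real.exp (-(t ^ 2 * y ^ 2)))
    fun l => integrable_psi₁_mul _ (by fun_prop)

theorem integral_psi_mul_exp {d : ℕ} (b : ℝ) (n : ℕ) (i : Fin d → Fin n) (t : ℝ) :
    ∫ x : EuclideanSpace ℝ (Fin d), psi b n i x * Real.exp (-(t ^ 2 * ‖x‖ ^ 2)) =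
      ∏ l, gaussVec b n t (i l) := by
  simp_rw [psi_mul_exp_eq]
  rw [← (PiLp.volume_preserving_toLp (Fin d)).integral_comp
    (MeasurableEquiv.toLp 2 _).measurableEmbedding]
  exact integral_fintype_prod_volume_eq_prod
    (fun l y => psi₁ b n (i l) y * Real.exp (-(t ^ 2 * y ^ 2)))

/-- Fubini's theorem for the projection tensor of a Laplace–Gauss transform. -/
theorem integrable_psi_mul_and_projTensor_eq {d n : ℕ} (hd : 1 ≤ d) {b : ℝ} {a q : ℝ → ℝ}
    (ha : ContinuousOn a (Ioi 0)) (hpos : ∀ t, 0 < t → 0 < a t) (hq : IsLaplaceGauss a q)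
    (i : Fin d → Fin n)
    (hint : IntegrableOn (fun t => a t * ∏ l, gaussVec b n t (i l)) (Ioi 0)) :
    Integrable (fun x : EuclideanSpace ℝ (Fin d) => psi b n i x * q ‖x‖) ∧
      projTensor d n b q i = ∫ t in Ioi 0, a t * ∏ l, gaussVec b n t (i l) := by
  have : Nonempty (Fin d) := ⟨⟨0, hd⟩⟩
  set H : EuclideanSpace ℝ (Fin d) → ℝ → ℝ := fun x t =>
    a t * (psi b n i x * Real.exp (-(t ^ 2 * ‖x‖ ^ 2))) with hH
  have hHm : AEStronglyMeasurable (Function.uncurry H)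
      ((volume : Measure (EuclideanSpace ℝ (Fin d))).prod (volume.restrict (Ioi 0))) := by
    refine AEStronglyMeasurable.mul ?_ (Measurable.aestronglyMeasurable ?_)
    · exact (ha.aestronglyMeasurable measurableSet_Ioi).comp_snd
    · exact ((measurable_psi b n i).comp measurable_fst).mul (by fun_prop)
  have hHi : Integrable (Function.uncurry H)
      ((volume : Measure (EuclideanSpace ℝ (Fin d))).prod (volume.restrict (Ioi 0))) := by
    rw [integrable_prod_iff' hHm]
    refine ⟨Filter.Eventually.of_forall fun t => (integrable_psi_mul_exp b n i t).const_mul (a t), ?_⟩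
    -- All factors are nonnegative, so the integral over `x` of the norm is the integrand already
    -- assumed integrable in `t`.
    refine hint.congr_fun (fun t ht => ?_) measurableSet_Ioi
    beta_reduce
    rw [← integral_psi_mul_exp, ← integral_const_mul]
    refine integral_congr_ae (Filter.Eventually.of_forall fun x => ?_)
    exact (Real.norm_of_nonneg (mul_nonneg (hpos t ht).le
      (mul_nonneg (psi_nonneg _ _ _ _) (Real.exp_pos _).le))).symm
  have hae : (fun x => ∫ t in Ioi 0, H x t) =ᵐ[volume]
      fun x : EuclideanSpace ℝ (Fin d) => psi b n i x * q ‖x‖ := by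
    -- The representation of `q` holds only for `p > 0`; the origin is a null set because `d ≥ 1`.
    filter_upwards [Measure.ae_ne volume (0 : EuclideanSpace ℝ (Fin d))] with x hx
    rw [(hq ‖x‖ (norm_pos_iff.mpr hx)).2, ← integral_const_mul]
    refine integral_congr_ae (Filter.Eventually.of_forall fun t => ?_)
    simp only [hH]
    ring
  refine ⟨hHi.integral_prod_left.congr hae, ?_⟩
  rw [projTensor, ← integral_congr_ae hae, integral_integral_swap hHi]
  refine integral_congr_ae (Filter.Eventually.of_forall fun t => ?_)
  simp only [hH]
  rw [integral_const_mul, integral_psi_mul_exp]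

theorem step_nonneg {C₀ : ℝ} (hC₀ : 0 < C₀) (M : ℕ) : 0 ≤ step C₀ M :=
  div_nonneg hC₀.le (Real.sqrt_nonneg _)

theorem weight_nonneg {a : ℝ → ℝ} {a₀ h : ℝ} (ha : ∀ t, 0 < t → 0 < a t) (ha₀ : 0 < a₀) (hh : 0 ≤ h)
    (k : ℤ) : 0 ≤ weight a a₀ h k := by
  have hn : 0 < node a₀ h k := div_pos (Real.exp_pos _) ha₀
  exact mul_nonneg (mul_nonneg hh hn.le) (ha _ hn).le

theorem prod_skeleton {d n : ℕ} (hd : 1 ≤ d) (b : ℝ) {a : ℝ → ℝ} {a₀ h : ℝ}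
    (ha : ∀ t, 0 < t → 0 < a t) (ha₀ : 0 < a₀) (hh : 0 ≤ h) (k : ℤ) (i : Fin d → Fin n) :
    ∏ l, skeleton d n b a a₀ h k (i l) =
      weight a a₀ h k * ∏ l, gaussVec b n (node a₀ h k) (i l) := by
  simp only [skeleton]
  rw [Finset.prod_mul_distrib, Finset.prod_const, Finset.card_univ, Fintype.card_fin, one_div,
    Real.rpow_inv_natCast_pow (weight_nonneg ha ha₀ hh k) (by omega)]

/-- The growth of `r^s (1+r)^m P` in logarithmic coordinates, for `P ≤ G^d min (1, r^{-d})`. -/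
theorem rpow_mul_one_add_rpow_mul_le {d : ℕ} {s m r G P : ℝ} (hm : 0 ≤ m)
    (hr : 0 < r) (hG : 0 ≤ G) (hP : 0 ≤ P) (h1 : P ≤ G ^ d)
    (h2 : P ≤ (G / r) ^ d) :
    r ^ s * (1 + r) ^ m * P ≤
      2 ^ m * G ^ d * Real.exp (-(min s (d - s - m) * |Real.log r|)) := by
  rcases le_total r 1 with h | h
  · rw [abs_of_nonpos (Real.log_nonpos hr.le h)]
    have h3 : r ^ s ≤ Real.exp (-(min s (d - s - m) * -Real.log r)) := by
      rw [Real.rpow_def_of_pos hr, Real.exp_le_exp, mul_neg, neg_neg, mul_comm]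
      exact mul_le_mul_of_nonpos_right (min_le_left _ _) (Real.log_nonpos hr.le h)
    have h4 : (1 + r) ^ m ≤ 2 ^ m := Real.rpow_le_rpow (by positivity) (by linarith) hm
    calc r ^ s * (1 + r) ^ m * P ≤ Real.exp (-(min s (d - s - m) * -Real.log r)) * 2 ^ m * G ^ d := by
          gcongr
      _ = _ := by ring
  · rw [abs_of_nonneg (Real.log_nonneg h)]
    have h3 : r ^ (-(d - s - m : ℝ)) ≤ Real.exp (-(min s (d - s - m) * Real.log r)) := by
      rw [Real.rpow_def_of_pos hr, Real.exp_le_exp, mul_neg, mul_comm]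
      exact neg_le_neg (mul_le_mul_of_nonneg_right (min_le_right _ _) (Real.log_nonneg h))
    have h4 : (1 + r) ^ m ≤ (2 * r) ^ m := Real.rpow_le_rpow (by positivity) (by linarith) hm
    calc r ^ s * (1 + r) ^ m * P ≤ r ^ s * (2 * r) ^ m * (G / r) ^ d := by gcongr
      _ = 2 ^ m * G ^ d * r ^ (-(d - s - m : ℝ)) := by
        rw [Real.mul_rpow zero_le_two hr.le, div_pow, ← Real.rpow_natCast r d,
          show -(d - s - m : ℝ) = s + m - d by ring, Real.rpow_sub hr, Real.rpow_add hr]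
        field_simp
      _ ≤ _ := by gcongr

theorem SectorWeight.continuousOn {a : ℝ → ℝ} {δ s m K : ℝ} (h : SectorWeight a δ s m K)
    (hδ : 0 < δ) : ContinuousOn a (Ioi 0) := by
  obtain ⟨A, hA, hr, -⟩ := h.analytic
  have h1 : ContinuousOn (fun t : ℝ => (A t).re) (Ioi 0) :=
    Complex.continuous_re.comp_continuousOn (hA.continuousOn.comp
      Complex.continuous_ofReal.continuousOn fun t ht => ofReal_mem_sector hδ ht)
  exact h1.congr fun t ht => by simp only [hr t ht, Complex.ofReal_re]

/-- The quadrature is applied to the scalar integral `∫ a(t) ∏ b_{i_l}(t) dt` of each entry, not to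
`q(‖x‖)` under the integral, so the lower bound on `‖x‖` disappears. The rate `min s (d - s - m)`
records the decay at `t → 0` and at `t → ∞`. -/
theorem exists_sincTensorApprox {d : ℕ} {δ s m C₀ a₀ b : ℝ} (hd : 1 ≤ d) (hδ : 0 < δ) (hs : 0 < s)
    (hm : 0 ≤ m) (hsm : s + m < d) (hC₀ : 0 < C₀) (ha₀ : 0 < a₀) (hb : 0 < b) :
    ∃ C β : ℝ, 0 < C ∧ 0 < β ∧ ∀ (a q : ℝ → ℝ) (K : ℝ), SectorWeight a δ s m K →
      IsLaplaceGauss a q → ∀ n : ℕ, 1 ≤ n →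
        (∀ M : ℕ, 1 ≤ M → SincTensorApprox d n b q a a₀ (step C₀ M) M
          (C * K * Real.exp (-(β * Real.sqrt M)))) ∧ 0 < ‖projTensor d n b q‖ := by
  have hpi := Real.pi_pos
  set D := min δ (Real.pi / 6) with hDdef
  have hD6 : D ≤ Real.pi / 6 := min_le_right _ _
  set b' := min s (d - s - m)
  have hb' : 0 < b' := lt_min hs (by linarith)
  obtain ⟨C, β, hC, hβ, H⟩ := exists_sector_quadrature_bound (D := D) (b := b')
    (by rw [hDdef]; positivity) (by linarith) hb' hC₀
  set G := max (2 * b) (Real.sqrt (2 * Real.pi))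
  have hG : 0 < G := lt_max_of_lt_left (by positivity)
  refine ⟨C * (2 ^ m * G ^ d * Real.exp (b' * |Real.log a₀|)), β, by positivity, hβ,
    fun a q K ha hq n hn => ?_⟩
  have hK := ha.nonneg hδ
  obtain ⟨A, hA, hAr, hAb⟩ := ha.analytic
  have hsub : sector D ⊆ sector δ := sector_mono (min_le_left _ _)
  have key : ∀ i : Fin d → Fin n, _ := fun i =>
    H (fun z => A z * ∏ l, gaussVecC b n z (i l)) (fun t => a t * ∏ l, gaussVec b n t (i l)) a₀
    (2 ^ m * G ^ d * Real.exp (b' * |Real.log a₀|) * K) ha₀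
    ((hA.mono hsub).mul (DifferentiableOn.fun_finsetProd fun l _ =>
      (differentiable_gaussVecC b n (i l)).differentiableOn))
    (fun t ht => by
      rw [hAr t ht]
      simp_rw [gaussVecC_ofReal hb]
      push_cast; rfl) (fun w hw => by
      set r := ‖w‖ with hr
      have hr0 : 0 < r := norm_pos_iff.mpr hw.1
      have h1 := hAb w (hsub hw)
      have h2 := fun l => norm_gaussVecC_le hb hn hD6 hw (i l)
      have hP1 : ‖∏ l, gaussVecC b n w (i l)‖ ≤ G ^ d := by
        rw [norm_prod]
        refine (Finset.prod_le_prod (fun _ _ => norm_nonneg _)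
          fun l _ => (h2 l).1.trans (le_max_left _ (Real.sqrt (2 * Real.pi)))).trans ?_
        rw [Finset.prod_const, Finset.card_univ, Fintype.card_fin]
      have hP2 : ‖∏ l, gaussVecC b n w (i l)‖ ≤ (G / r) ^ d := by
        rw [norm_prod]
        refine (Finset.prod_le_prod (fun _ _ => norm_nonneg _)
          fun l _ => (h2 l).2.trans (div_le_div_of_nonneg_right (le_max_right (2 * b) _)
            hr0.le)).trans ?_
        rw [Finset.prod_const, Finset.card_univ, Fintype.card_fin]
      have h3 := rpow_mul_one_add_rpow_mul_le (s := s) hm hr0 hG.le (norm_nonneg _) hP1 hP2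
      -- The integrand decays around `r = 1`, while the nodes are centred at `r = 1/a₀`; recentring
      -- costs the constant `e^{b'|log a₀|}`.
      have h4 : Real.exp (-(b' * |Real.log r|)) ≤
          Real.exp (b' * |Real.log a₀|) * Real.exp (-(b' * |Real.log (a₀ * r)|)) := by
        rw [← Real.exp_add, Real.exp_le_exp, Real.log_mul ha₀.ne' hr0.ne']
        have := mul_le_mul_of_nonneg_left (abs_add_le (Real.log a₀) (Real.log r)) hb'.le
        linarith
      rw [norm_mul]
      calc r * (‖A w‖ * ‖∏ l, gaussVecC b n w (i l)‖)
          ≤ r * ((K * r ^ (s - 1) * (1 + r) ^ m) * ‖∏ l, gaussVecC b n w (i l)‖) := by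
            gcongr
        _ = K * (r ^ s * (1 + r) ^ m * ‖∏ l, gaussVecC b n w (i l)‖) := by
            rw [Real.rpow_sub_one hr0.ne']
            field_simp
        _ ≤ K * (2 ^ m * G ^ d * Real.exp (-(b' * |Real.log r|))) :=
            mul_le_mul_of_nonneg_left h3 hK
        _ ≤ K * (2 ^ m * G ^ d * (Real.exp (b' * |Real.log a₀|) *
              Real.exp (-(b' * |Real.log (a₀ * r)|)))) := by gcongr
        _ = _ := by ring)
  have hfub := fun i => integrable_psi_mul_and_projTensor_eq hd (ha.continuousOn hδ) ha.pos hq i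
    (key i).1
  have hprod := fun (M : ℕ) k (i : Fin d → Fin n) =>
    prod_skeleton hd b ha.pos ha₀ (step_nonneg hC₀ M) k i
  have hcp : ∀ M : ℕ, ∃ w : Fin (2 * M + 1) → EuclideanSpace ℝ (Fin n), ∀ i : Fin d → Fin n,
      sincTensor d n b a a₀ (step C₀ M) M i = ∑ k, ∏ l, w k (i l) := fun M => by
    obtain ⟨w, hw⟩ := exists_sum_Icc_eq_sum_fin M
      (fun k => (WithLp.toLp 2 (skeleton d n b a a₀ (step C₀ M) k) : EuclideanSpace ℝ (Fin n)))
    exact ⟨w, fun i => hw fun x => ∏ l, x (i l)⟩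
  refine ⟨fun M hM => ?_, ?_⟩
  · obtain ⟨w, hw⟩ := hcp M
    have hexp : ∀ i : Fin d → Fin n, sincTensor d n b a a₀ (step C₀ M) M i =
        ∑ k ∈ Finset.Icc (-(M : ℤ)) (M : ℤ), weight a a₀ (step C₀ M) k *
          ∏ l, gaussVec b n (node a₀ (step C₀ M) k) (i l) := fun i =>
      Finset.sum_congr rfl fun k _ => hprod M k i
    refine ⟨fun i => (hfub i).1, hexp, hasCPForm_of_eq_sum_prod hn w hw,
      hasTuckerForm_of_eq_sum_prod w hw, ?_⟩
    rw [pi_norm_le_iff_of_nonneg (by positivity)]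
    intro i
    rw [Pi.sub_apply, hexp, (hfub i).2, Real.norm_eq_abs]
    refine le_trans (le_of_eq ?_) (((key i).2 M hM).trans (le_of_eq ?_))
    · congr 2
      refine Finset.sum_congr rfl fun k _ => ?_
      simp only [weight]
      ring
    · ring
  -- Every entry is the integral of a strictly positive function, so any multi-index shows that the
  -- tensor is nonzero.
  · have i : Fin d → Fin n := fun _ => ⟨0, hn⟩
    refine lt_of_lt_of_le ?_ (norm_le_pi_norm (projTensor d n b q) i)
    have hpos : ∀ t ∈ Ioi (0 : ℝ), 0 < a t * ∏ l, gaussVec b n t (i l) := fun t ht =>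
      mul_pos (ha.pos t ht) (Finset.prod_pos fun l _ => gaussVec_pos hb hn _ _)
    have : 0 < projTensor d n b q i := by
      rw [(hfub i).2, setIntegral_pos_iff_support_of_nonneg_ae
        ((ae_restrict_mem measurableSet_Ioi).mono fun t ht => (hpos t ht).le) (key i).1,
        inter_eq_self_of_subset_right
          (show Ioi (0 : ℝ) ⊆ Function.support _ from fun t ht => (hpos t ht).ne')]
      simp
    exact norm_pos_iff.mpr this.ne'

theorem exists_forall_le_mul_of_exp_bound {C β N : ℝ} {E : ℕ → ℝ} (hβ : 0 < β) (hN : 0 < N)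
    (hE : ∀ M : ℕ, 1 ≤ M → E M ≤ C * Real.exp (-(β * Real.sqrt M))) {ε : ℝ} (hε : 0 < ε) :
    ∃ M₀ : ℕ, ∀ M : ℕ, M₀ ≤ M → E M ≤ ε * N := by
  have h1 : Filter.Tendsto (fun M : ℕ => C * Real.exp (-(β * Real.sqrt M))) Filter.atTop
      (nhds (C * 0)) :=
    (Real.tendsto_exp_neg_atTop_nhds_zero.comp ((Real.tendsto_sqrt_atTop.comp
      tendsto_natCast_atTop_atTop).const_mul_atTop hβ)).const_mul C
  rw [mul_zero] at h1
  obtain ⟨M₀, hM₀⟩ := Filter.eventually_atTop.mp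
    (h1.eventually_le_const (show 0 < ε * N by positivity))
  exact ⟨max M₀ 1, fun M hM => (hE M ((le_max_right _ _).trans hM)).trans
    (hM₀ M ((le_max_left _ _).trans hM))⟩

/-! ### Kernels of Matérn type -/

theorem sector_pi_div_six_subset_slitPlane : sector (Real.pi / 6) ⊆ Complex.slitPlane := by
  intro z hz
  rw [Complex.mem_slitPlane_iff_arg]
  refine ⟨fun h => ?_, hz.1⟩
  have h1 : |z.arg| < Real.pi / 6 := hz.2
  rw [h, abs_of_pos Real.pi_pos] at h1
  linarith [Real.pi_pos]

theorem inv_mem_sector {z : ℂ} (hz : z ∈ sector (Real.pi / 6)) :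
    z⁻¹ ∈ sector (Real.pi / 6) := by
  refine ⟨inv_ne_zero hz.1, ?_⟩
  rw [Complex.abs_arg_inv]
  exact hz.2

theorem differentiableOn_cpow_sector (κ : ℝ) :
    DifferentiableOn ℂ (fun z : ℂ => z ^ (κ : ℂ)) (sector (Real.pi / 6)) := fun _ hz =>
  (differentiableAt_id.cpow_const
    (sector_pi_div_six_subset_slitPlane hz)).differentiableWithinAt

/-- The surplus power `κ - (s - 1) ≥ 0` is absorbed by the Gaussian at infinity. Writing `γ = (√γ)²`
makes the sector bound for `e^{-z²y²}` applicable. -/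
theorem exists_sectorWeight_rpow_mul_exp_neg_mul_sq {c κ γ s : ℝ} (hc : 0 < c) (hγ : 0 < γ)
    (hκs : s - 1 ≤ κ) :
    ∃ K, 0 < K ∧ SectorWeight (fun t => c * t ^ κ * Real.exp (-(γ * t ^ 2)))
      (Real.pi / 6) s 0 K := by
  refine ⟨c * Real.exp ((κ - (s - 1)) ^ 2 / (4 * (γ / 2))), by positivity, fun t ht => by positivity,
    fun z => c * z ^ (κ : ℂ) * Complex.exp (-(z ^ 2 * ((Real.sqrt γ : ℝ) : ℂ) ^ 2)), ?_, ?_, ?_⟩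
  · exact ((differentiableOn_cpow_sector κ).const_mul _).mul (by fun_prop)
  · intro t ht
    rw [← Complex.ofReal_pow (Real.sqrt γ), Real.sq_sqrt hγ.le, mul_comm γ]
    push_cast [Complex.ofReal_cpow ht.le]
    rfl
  · intro z hz
    have hr : 0 < ‖z‖ := norm_pos_iff.mpr hz.1
    have h1 := norm_exp_neg_sq_mul_sq_le le_rfl hz (Real.sqrt γ)
    rw [Real.sq_sqrt hγ.le] at h1
    rw [norm_mul, norm_mul, Complex.norm_cpow_real, Complex.norm_real, Real.norm_of_nonneg hc.le,
      Real.rpow_zero, mul_one]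
    have h2 := rpow_mul_exp_neg_mul_sq_le (n := κ - (s - 1)) hr (by linarith) (half_pos hγ)
    calc c * ‖z‖ ^ κ * ‖Complex.exp (-(z ^ 2 * ((Real.sqrt γ : ℝ) : ℂ) ^ 2))‖
        ≤ c * ‖z‖ ^ κ * Real.exp (-(‖z‖ ^ 2 / 2 * γ)) := by gcongr
      _ = c * (‖z‖ ^ (κ - (s - 1)) * Real.exp (-(γ / 2 * ‖z‖ ^ 2))) * ‖z‖ ^ (s - 1) := by
        rw [show ‖z‖ ^ κ = ‖z‖ ^ (κ - (s - 1)) * ‖z‖ ^ (s - 1) by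
          rw [← Real.rpow_add hr]; ring_nf]
        ring_nf
      _ ≤ _ := by gcongr

/-- Inversion preserves the sector and exchanges `0` with `∞`: the factor `e^{-γ/z²}` now absorbs
the singular power at the origin. -/
theorem exists_sectorWeight_rpow_mul_exp_neg_div_sq {c κ γ s : ℝ} (hc : 0 < c) (hγ : 0 < γ)
    (hκs : κ ≤ s - 1) :
    ∃ K, 0 < K ∧ SectorWeight (fun t => c * t ^ κ * Real.exp (-(γ / t ^ 2)))
      (Real.pi / 6) s 0 K := by
  refine ⟨c * Real.exp ((s - 1 - κ) ^ 2 / (4 * (γ / 2))), by positivity, fun t ht => by positivity,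
    fun z => c * z ^ (κ : ℂ) * Complex.exp (-(z⁻¹ ^ 2 * ((Real.sqrt γ : ℝ) : ℂ) ^ 2)), ?_, ?_, ?_⟩
  · refine ((differentiableOn_cpow_sector κ).const_mul _).mul (DifferentiableOn.cexp ?_)
    exact (((differentiableOn_id.inv fun z hz => hz.1).pow 2).mul_const _).neg
  · intro t ht
    rw [← Complex.ofReal_pow (Real.sqrt γ), Real.sq_sqrt hγ.le, div_eq_inv_mul, ← inv_pow]
    push_cast [Complex.ofReal_cpow ht.le]
    rfl
  · intro z hz
    have hr : 0 < ‖z‖ := norm_pos_iff.mpr hz.1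
    have h1 := norm_exp_neg_sq_mul_sq_le le_rfl (inv_mem_sector hz) (Real.sqrt γ)
    rw [Real.sq_sqrt hγ.le, norm_inv] at h1
    rw [norm_mul, norm_mul, Complex.norm_cpow_real, Complex.norm_real, Real.norm_of_nonneg hc.le,
      Real.rpow_zero, mul_one]
    have h2 := rpow_mul_exp_neg_mul_sq_le (n := s - 1 - κ) (inv_pos.mpr hr) (by linarith)
      (half_pos hγ)
    calc c * ‖z‖ ^ κ * ‖Complex.exp (-(z⁻¹ ^ 2 * ((Real.sqrt γ : ℝ) : ℂ) ^ 2))‖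
        ≤ c * ‖z‖ ^ κ * Real.exp (-(‖z‖⁻¹ ^ 2 / 2 * γ)) := by gcongr
      _ = c * (‖z‖⁻¹ ^ (s - 1 - κ) * Real.exp (-(γ / 2 * ‖z‖⁻¹ ^ 2))) * ‖z‖ ^ (s - 1) := by
        rw [show ‖z‖ ^ κ = ‖z‖⁻¹ ^ (s - 1 - κ) * ‖z‖ ^ (s - 1) by
          rw [Real.inv_rpow hr.le, ← Real.rpow_neg hr.le, ← Real.rpow_add hr]; ring_nf]
        ring_nf
      _ ≤ _ := by gcongr

theorem SectorWeight.integrableOn_mul_exp {a : ℝ → ℝ} {δ K : ℝ} (h : SectorWeight a δ 1 0 K)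
    (hδ : 0 < δ) {p : ℝ} (hp : 0 < p) :
    IntegrableOn (fun t : ℝ => a t * Real.exp (-(t ^ 2 * p ^ 2))) (Ioi 0) := by
  have hg : IntegrableOn (fun t : ℝ => K * Real.exp (-(t ^ 2 * p ^ 2))) (Ioi 0) := by
    have := (integrable_exp_neg_mul_sq (show 0 < p ^ 2 by positivity)).const_mul K
    simp only [neg_mul, mul_comm (p ^ 2)] at this
    exact this.integrableOn
  refine hg.mono' (((h.continuousOn hδ).mul (by fun_prop)).aestronglyMeasurable measurableSet_Ioi) ?_
  filter_upwards [ae_restrict_mem measurableSet_Ioi] with t ht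
  obtain ⟨A, -, hr, hA⟩ := h.analytic
  have h1 := hA t (ofReal_mem_sector hδ ht)
  rw [hr t ht, Complex.norm_real, sub_self, Real.rpow_zero, Real.rpow_zero, mul_one, mul_one] at h1
  rw [norm_mul, Real.norm_of_nonneg (Real.exp_pos _).le]
  gcongr

/-- This is the Gamma integral with parameter `α² + p²`. For `μ ≥ 1/2` the power `2μ - 1` is
nonnegative, so the weight is bounded and convergence is immediate. -/
theorem isLaplaceGauss_spectral {c α μ : ℝ} (hc : 0 < c) (hα : 0 < α) (hμ : 1 / 2 ≤ μ) :
    IsLaplaceGauss (fun t => 2 * c / Real.Gamma μ * t ^ (2 * μ - 1) * Real.exp (-(α ^ 2 * t ^ 2)))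
      (fun ρ => c / (α ^ 2 + ρ ^ 2) ^ μ) := by
  have hΓ : 0 < Real.Gamma μ := Real.Gamma_pos_of_pos (by linarith)
  intro p hp
  obtain ⟨K, -, hK⟩ := exists_sectorWeight_rpow_mul_exp_neg_mul_sq (c := 2 * c / Real.Gamma μ)
    (κ := 2 * μ - 1) (s := 1) (by positivity) (show 0 < α ^ 2 by positivity) (by linarith)
  refine ⟨hK.integrableOn_mul_exp (by positivity) hp, ?_⟩
  have h := integral_rpow_mul_exp_neg_mul_rpow (p := 2) (q := 2 * μ - 1) (b := α ^ 2 + p ^ 2)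
    two_pos (by linarith) (by positivity)
  have h1 : ∀ t : ℝ, 2 * c / Real.Gamma μ * t ^ (2 * μ - 1) * Real.exp (-(α ^ 2 * t ^ 2)) *
      Real.exp (-(t ^ 2 * p ^ 2)) = 2 * c / Real.Gamma μ * (t ^ (2 * μ - 1) *
        Real.exp (-(α ^ 2 + p ^ 2) * t ^ (2 : ℝ))) := fun t => by
    rw [mul_assoc, ← Real.exp_add, mul_assoc, Real.rpow_two]
    ring_nf
  simp_rw [h1]
  rw [integral_const_mul, h, show (2 * μ - 1 + 1) / 2 = μ by ring,
    show -(2 * μ - 1 + 1) / 2 = -μ by ring, Real.rpow_neg (by positivity)]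
  field_simp

/-- A Laplace–Gauss integral representation of the modified Bessel function. -/
theorem integral_rpow_mul_exp_eq_besselK {ν γ p : ℝ} (hγ : 0 < γ) (hp : 0 < p)
    (hint : IntegrableOn (fun t : ℝ => t ^ (-(2 * ν) - 1) * Real.exp (-(γ / t ^ 2)) *
      Real.exp (-(t ^ 2 * p ^ 2))) (Ioi 0)) :
    ∫ t in Ioi (0 : ℝ), t ^ (-(2 * ν) - 1) * Real.exp (-(γ / t ^ 2)) *
      Real.exp (-(t ^ 2 * p ^ 2)) = (p / Real.sqrt γ) ^ ν * besselK ν (2 * Real.sqrt γ * p) := by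
  have hs : 0 < Real.sqrt γ := Real.sqrt_pos.mpr hγ
  set z := 2 * Real.sqrt γ * p with hz
  -- This scale balances the two exponents: with `t = e^u/a₀`, `γ/t²` and `t²p²` become `√γ p
  -- e^{-2u}` and `√γ p e^{2u}`, whose sum is `z cosh(2u)`.
  have ha₀ : 0 < Real.sqrt (p / Real.sqrt γ) := Real.sqrt_pos.mpr (by positivity)
  set a₀ := Real.sqrt (p / Real.sqrt γ) with ha₀def
  have ha₀sq : a₀ ^ 2 = p / Real.sqrt γ := Real.sq_sqrt (by positivity)
  have hγsq : Real.sqrt γ ^ 2 = γ := Real.sq_sqrt hγ.le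
  set Φ : ℝ → ℝ := fun u => Real.exp (-(2 * ν * u)) * Real.exp (-(z * Real.cosh (2 * u))) with hΦ
  have hsub : ∀ u : ℝ, (Real.exp u / a₀) • ((Real.exp u / a₀) ^ (-(2 * ν) - 1) *
      Real.exp (-(γ / (Real.exp u / a₀) ^ 2)) * Real.exp (-((Real.exp u / a₀) ^ 2 * p ^ 2))) =
      (p / Real.sqrt γ) ^ ν * Φ u := by
    intro u
    have ht : 0 < Real.exp u / a₀ := by positivity
    have hsq : (Real.exp u / a₀) ^ 2 = Real.exp (2 * u) * (Real.sqrt γ / p) := by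
      rw [div_pow, ha₀sq, ← Real.exp_nat_mul]
      push_cast
      field_simp
    have h1 : γ / (Real.exp u / a₀) ^ 2 + (Real.exp u / a₀) ^ 2 * p ^ 2 =
        z * Real.cosh (2 * u) := by
      rw [hsq, Real.cosh_eq, Real.exp_neg, hz, ← hγsq]
      simp only [Real.sqrt_sq hs.le]
      field_simp
      ring
    have h2 : (Real.exp u / a₀) * (Real.exp u / a₀) ^ (-(2 * ν) - 1) =
        (p / Real.sqrt γ) ^ ν * Real.exp (-(2 * ν * u)) := by
      rw [Real.rpow_sub_one ht.ne', mul_div_cancel₀ _ ht.ne', Real.div_rpow (Real.exp_pos _).le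
        ha₀.le, ← Real.exp_mul, Real.rpow_neg ha₀.le, Real.rpow_mul ha₀.le, Real.rpow_two, ha₀sq,
        div_inv_eq_mul, mul_comm]
      ring_nf
    rw [smul_eq_mul, mul_assoc, ← Real.exp_add, ← mul_assoc, h2, mul_assoc]
    simp only [hΦ]
    rw [← h1, neg_add]
  have hΦi : Integrable Φ := by
    rw [integrableOn_Ioi_iff_exp_div ha₀] at hint
    simp_rw [hsub] at hint
    have hne : (p / Real.sqrt γ) ^ ν ≠ 0 := (Real.rpow_pos_of_pos (by positivity) _).ne'
    simpa [inv_mul_cancel_left₀ hne] using hint.const_mul ((p / Real.sqrt γ) ^ ν)⁻¹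
  rw [integral_Ioi_eq_integral_exp_div ha₀]
  simp_rw [hsub]
  rw [integral_const_mul]
  congr 1
  -- Averaging over `u ↦ -u` turns `e^{-2νu}` into a hyperbolic cosine; evenness and the scaling `u
  -- ↦ 2u` then give the integral defining `K_ν`.
  have hsym : 2 * ∫ u, Φ u = ∫ u, 2 * (Real.exp (-(z * Real.cosh (2 * |u|))) *
      Real.cosh (ν * (2 * |u|))) := by
    rw [two_mul]
    nth_rewrite 2 [← integral_neg_eq_self]
    rw [← integral_add hΦi hΦi.comp_neg]
    refine integral_congr_ae (Filter.Eventually.of_forall fun u => ?_)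
    have h1 : Real.cosh (2 * |u|) = Real.cosh (2 * u) := by
      rw [← Real.cosh_abs (2 * u), abs_mul, abs_two]
    have h2 : Real.cosh (ν * (2 * |u|)) = Real.cosh (2 * ν * u) := by
      rw [← Real.cosh_abs (2 * ν * u), ← Real.cosh_abs (ν * (2 * |u|))]
      simp only [abs_mul, abs_abs]
      ring_nf
    simp only [hΦ]
    rw [h1, h2, mul_neg 2 u, Real.cosh_neg, Real.cosh_eq (2 * ν * u)]
    ring_nf
  rw [integral_const_mul, integral_comp_abs (f := fun u => Real.exp (-(z * Real.cosh (2 * u))) *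
      Real.cosh (ν * (2 * u))),
    integral_comp_mul_left_Ioi (fun u => Real.exp (-(z * Real.cosh u)) * Real.cosh (ν * u)) 0
      two_pos, mul_zero] at hsym
  rw [besselK]
  simp only [smul_eq_mul] at hsym
  linarith

/-- Since `cosh t = 1 + 2 sinh²(t/2)`, the substitution `w = sinh(t/2)` has Jacobian proportional to
`cosh(t/2)` and leaves a half-line Gaussian. For `z ≤ 0` both sides take the default value zero. -/
theorem besselK_one_half (z : ℝ) :
    besselK (1 / 2) z = Real.sqrt (Real.pi / (2 * z)) * Real.exp (-z) := by
  have himg : (fun t : ℝ => Real.sinh (t / 2)) '' Ioi 0 = Ioi 0 := by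
    ext w
    simp only [mem_image, mem_Ioi]
    refine ⟨?_, fun hw => ⟨2 * Real.arsinh w, ?_, ?_⟩⟩
    · rintro ⟨t, ht, rfl⟩
      exact Real.sinh_pos_iff.mpr (by positivity)
    · have := Real.arsinh_pos_iff.mpr hw
      positivity
    · rw [mul_div_cancel_left₀ _ two_ne_zero, Real.sinh_arsinh]
  have h := integral_image_eq_integral_abs_deriv_smul (s := Ioi (0 : ℝ)) measurableSet_Ioi
    (f := fun t => Real.sinh (t / 2)) (f' := fun t => Real.cosh (t / 2) * (1 / 2))
    (fun t _ => (((hasDerivAt_id t).div_const 2).sinh).hasDerivWithinAt)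
    (fun t _ u _ htu => by
      have := Real.sinh_injective htu
      linarith) (fun w => Real.exp (-(2 * z) * w ^ 2))
  rw [himg, integral_gaussian_Ioi] at h
  have h2 : besselK (1 / 2) z = ∫ t in Ioi (0 : ℝ), 2 * Real.exp (-z) *
      (|Real.cosh (t / 2) * (1 / 2)| • Real.exp (-(2 * z) * Real.sinh (t / 2) ^ 2)) := by
    refine integral_congr_ae (Filter.Eventually.of_forall fun t => ?_)
    have hc : Real.cosh t = 1 + 2 * Real.sinh (t / 2) ^ 2 := by
      have h3 := Real.cosh_two_mul (t / 2)
      have h4 := Real.cosh_sq (t / 2)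
      rw [mul_div_cancel₀ _ two_ne_zero] at h3
      linarith
    have h5 : Real.exp (-(z * Real.cosh t)) =
        Real.exp (-z) * Real.exp (-(2 * z) * Real.sinh (t / 2) ^ 2) := by
      rw [← Real.exp_add, hc]
      ring_nf
    have h6 : 0 ≤ Real.cosh (t / 2) * (1 / 2) := by
      have := Real.cosh_pos (t / 2)
      positivity
    simp only [smul_eq_mul]
    rw [abs_of_nonneg h6, h5]
    ring_nf
  rw [h2, integral_const_mul, ← h]
  ring

/-- Common source of the Slater function (`ν = 1/2`) and of the Matérn covariance (`γ = ν/(2ℓ²)`).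
-/
theorem isLaplaceGauss_of_besselK {c ν γ : ℝ} (hc : 0 < c) (hν : 0 < ν) (hγ : 0 < γ) :
    IsLaplaceGauss (fun t => c * t ^ (-(2 * ν) - 1) * Real.exp (-(γ / t ^ 2)))
      (fun r => c * ((r / Real.sqrt γ) ^ ν * besselK ν (2 * Real.sqrt γ * r))) := by
  intro p hp
  obtain ⟨K, -, hK⟩ := exists_sectorWeight_rpow_mul_exp_neg_div_sq (κ := -(2 * ν) - 1) (s := 1)
    hc hγ (by linarith)
  have hint := hK.integrableOn_mul_exp (by positivity) hp
  refine ⟨hint, ?_⟩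
  have h1 : ∀ t : ℝ, c * t ^ (-(2 * ν) - 1) * Real.exp (-(γ / t ^ 2)) *
      Real.exp (-(t ^ 2 * p ^ 2)) = c * (t ^ (-(2 * ν) - 1) * Real.exp (-(γ / t ^ 2)) *
        Real.exp (-(t ^ 2 * p ^ 2))) := fun t => by ring
  simp_rw [h1] at hint ⊢
  rw [integral_const_mul, integral_rpow_mul_exp_eq_besselK hγ hp]
  have h2 := hint.const_mul c⁻¹
  simp only [inv_mul_cancel_left₀ hc.ne'] at h2
  exact h2

theorem IsLaplaceGauss.congr {a q q' : ℝ → ℝ} (h : IsLaplaceGauss a q)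
    (hq : ∀ p, 0 < p → q' p = q p) : IsLaplaceGauss a q' := fun p hp =>
  ⟨(h p hp).1, (hq p hp).trans (h p hp).2⟩

theorem isLaplaceGauss_slater {α : ℝ} (hα : 0 < α) :
    IsLaplaceGauss (fun t => 2 * Real.sqrt α / Real.sqrt Real.pi * t ^ (-2 : ℝ) *
        Real.exp (-(α / t ^ 2)))
      (fun r => Real.exp (-(2 * Real.sqrt α * r))) := by
  have hs : 0 < Real.sqrt α := Real.sqrt_pos.mpr hα
  have hpi : 0 < Real.sqrt Real.pi := Real.sqrt_pos.mpr Real.pi_pos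
  have h := isLaplaceGauss_of_besselK (c := 2 * Real.sqrt α / Real.sqrt Real.pi) (ν := 1 / 2)
    (by positivity) one_half_pos hα
  -- Evaluates the exponent `-(2 · (1/2)) - 1` to `-2`.
  norm_num only at h
  refine h.congr fun p hp => ?_
  have h1 := besselK_one_half (2 * Real.sqrt α * p)
  norm_num only at h1
  rw [h1, ← Real.sqrt_eq_rpow, ← mul_assoc (Real.sqrt _), ← Real.sqrt_mul (by positivity),
    show p / Real.sqrt α * (Real.pi / (2 * (2 * Real.sqrt α * p))) =
      Real.pi / (2 * Real.sqrt α) ^ 2 by field_simp,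
    Real.sqrt_div Real.pi_pos.le, Real.sqrt_sq (by positivity)]
  field_simp

theorem isLaplaceGauss_maternCov {ν ell : ℝ} (hν : 0 < ν) (hell : 0 < ell) :
    IsLaplaceGauss (fun t => 2 / Real.Gamma ν * (ν / (2 * ell ^ 2)) ^ ν * t ^ (-(2 * ν) - 1) *
        Real.exp (-(ν / (2 * ell ^ 2) / t ^ 2)))
      (fun r => maternCov ν ell r) := by
  have hΓ : 0 < Real.Gamma ν := Real.Gamma_pos_of_pos hν
  have hγ : 0 < ν / (2 * ell ^ 2) := by positivity
  refine (isLaplaceGauss_of_besselK (c := 2 / Real.Gamma ν * (ν / (2 * ell ^ 2)) ^ ν)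
    (by positivity) hν hγ).congr fun p hp => ?_
  set γ := ν / (2 * ell ^ 2) with hγdef
  have hs : 0 < Real.sqrt γ := Real.sqrt_pos.mpr hγ
  have hz : Real.sqrt (2 * ν) * p / ell = 2 * Real.sqrt γ * p := by
    have : Real.sqrt (2 * ν) = Real.sqrt γ * (2 * ell) := by
      rw [← Real.sqrt_sq (show 0 ≤ 2 * ell by positivity), ← Real.sqrt_mul hγ.le, hγdef]
      congr 1
      field_simp
    rw [this]
    field_simp
  have hpow : γ ^ ν * (p / Real.sqrt γ) ^ ν = (Real.sqrt γ * p) ^ ν := by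
    rw [← Real.mul_rpow hγ.le (by positivity)]
    congr 1
    nth_rewrite 1 [← Real.sq_sqrt hγ.le]
    field_simp
  rw [maternCov, hz, show 2 * Real.sqrt γ * p = 2 * (Real.sqrt γ * p) by ring,
    Real.mul_rpow zero_le_two (by positivity), ← hpow, Real.rpow_sub two_pos, Real.rpow_one]
  field_simp

/-- The exponential factors leave freedom in `s`: the spectral weight needs `s - 1 ≤ 2ν + d - 1`,
the other two need their negative power to be at most `s - 1`. Both `s = 1` and `s = 1/2` are used
later. -/
theorem MaternType.isLaplaceGauss_and_sectorWeight {d : ℕ} {q a : ℝ → ℝ} (hd : 1 ≤ d)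
    (h : MaternType d q a) :
    IsLaplaceGauss a q ∧ ∀ s : ℝ, 1 / 2 ≤ s → s ≤ 1 →
      ∃ K, 0 < K ∧ SectorWeight a (Real.pi / 6) s 0 K := by
  have hpi : 0 < Real.sqrt Real.pi := Real.sqrt_pos.mpr Real.pi_pos
  have hd' : (1 : ℝ) ≤ d := by exact_mod_cast hd
  cases h with
  | spectral c α ν hc hα hν =>
    have hΓ : 0 < Real.Gamma (ν + (d : ℝ) / 2) := Real.Gamma_pos_of_pos (by positivity)
    have h := isLaplaceGauss_spectral (μ := ν + (d : ℝ) / 2) hc hα (by linarith)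
    rw [show 2 * (ν + (d : ℝ) / 2) - 1 = 2 * ν + (d : ℝ) - 1 by ring] at h
    exact ⟨h, fun s _ hs => exists_sectorWeight_rpow_mul_exp_neg_mul_sq (by positivity)
      (by positivity) (by linarith)⟩
  | slater α hα =>
    have hs : 0 < Real.sqrt α := Real.sqrt_pos.mpr hα
    exact ⟨isLaplaceGauss_slater hα, fun s hs _ => exists_sectorWeight_rpow_mul_exp_neg_div_sq
      (by positivity) hα (by linarith)⟩
  | covariance ν ell hν hell =>
    have hΓ : 0 < Real.Gamma ν := Real.Gamma_pos_of_pos hν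
    exact ⟨isLaplaceGauss_maternCov hν hell, fun s hs _ =>
      exists_sectorWeight_rpow_mul_exp_neg_div_sq (by positivity) (by positivity) (by linarith)⟩

end SincTensor

/-! ### Assembly of the four parts. -/

theorem mainTheorem1 :
    -- every Gaussian sum is separable
    (∀ (d : ℕ) (w g : ℤ → ℝ) (M : ℕ) (x : EuclideanSpace ℝ (Fin d)),
      SincTensor.gaussSum w g M x =
        ∑ k ∈ Finset.Icc (-(M : ℤ)) (M : ℤ), w k * ∏ l, Real.exp (-(g k * x l ^ 2))) ∧
    -- sinc quadrature for `q(p) = ∫_ℝ a₁(t) exp (-p² a₂(t)) dt`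
    (∀ D b C₀ : ℝ, 0 < D → 0 < b → 0 < C₀ →
      ∃ C β : ℝ, 0 < C ∧ 0 < β ∧
        ∀ (a₁ a₂ q : ℝ → ℝ) (p₀ B : ℝ), 0 < p₀ →
          SincTensor.StripWeights a₁ a₂ D b p₀ B →
          (∀ p : ℝ, p₀ ≤ p → q p = ∫ t : ℝ, a₁ t * Real.exp (-(p ^ 2 * a₂ t))) →
          (∀ p : ℝ, p₀ ≤ p →
            MeasureTheory.Integrable (fun t : ℝ => a₁ t * Real.exp (-(p ^ 2 * a₂ t)))) ∧
          ∀ (d M : ℕ), 1 ≤ M → ∀ x : EuclideanSpace ℝ (Fin d), p₀ ≤ ‖x‖ →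
            |q ‖x‖ - SincTensor.gaussSum
                (fun k => a₁ (k * SincTensor.step C₀ M) * SincTensor.step C₀ M)
                (fun k => a₂ (k * SincTensor.step C₀ M)) M x|
              ≤ C * B * Real.exp (-(β * Real.sqrt M))) ∧
    -- sinc quadrature for the Laplace–Gauss transform
    (∀ δ s m C₀ : ℝ, 0 < δ → 0 < s → 0 ≤ m → 0 < C₀ →
      ∃ C β : ℝ, 0 < C ∧ 0 < β ∧
        ∀ (a q : ℝ → ℝ) (K : ℝ), SincTensor.SectorWeight a δ s m K →
          SincTensor.IsLaplaceGauss a q →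
          ∀ a₀ : ℝ, 0 < a₀ → ∀ (d M : ℕ), 1 ≤ M →
            ∀ x : EuclideanSpace ℝ (Fin d), a₀ ≤ ‖x‖ →
              |q ‖x‖ - SincTensor.gaussSum
                  (SincTensor.weight a a₀ (SincTensor.step C₀ M))
                  (fun k => SincTensor.node a₀ (SincTensor.step C₀ M) k ^ 2) M x|
                ≤ C * K * a₀ ^ (-s) * (1 + 1 / a₀) ^ m * Real.exp (-(β * Real.sqrt M))) ∧
    -- canonical and Tucker approximation of the discretized kernel
    (∀ (d : ℕ) (δ s m C₀ a₀ b : ℝ), 1 ≤ d → 0 < δ → 0 < s → 0 ≤ m → s + m < d →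
      0 < C₀ → 0 < a₀ → 0 < b →
      ∃ C β : ℝ, 0 < C ∧ 0 < β ∧
        ∀ (a q : ℝ → ℝ) (K : ℝ), SincTensor.SectorWeight a δ s m K →
          SincTensor.IsLaplaceGauss a q →
          ∀ n : ℕ, 1 ≤ n →
            (∀ M : ℕ, 1 ≤ M →
              SincTensor.SincTensorApprox d n b q a a₀ (SincTensor.step C₀ M) M
                (C * K * Real.exp (-(β * Real.sqrt M)))) ∧
            ∀ ε : ℝ, 0 < ε → ∃ M₀ : ℕ, ∀ M : ℕ, M₀ ≤ M →
              ‖SincTensor.projTensor d n b q -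
                  SincTensor.sincTensor d n b a a₀ (SincTensor.step C₀ M) M‖
                ≤ ε * ‖SincTensor.projTensor d n b q‖) ∧
    -- kernels of Matérn type
    (∀ (d : ℕ) (q a : ℝ → ℝ), 1 ≤ d → SincTensor.MaternType d q a →
      SincTensor.IsLaplaceGauss a q ∧
      ∀ C₀ : ℝ, 0 < C₀ →
        (∃ C β : ℝ, 0 < C ∧ 0 < β ∧
          ∀ a₀ : ℝ, 0 < a₀ → ∀ M : ℕ, 1 ≤ M →
            ∀ x : EuclideanSpace ℝ (Fin d), a₀ ≤ ‖x‖ →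
              |q ‖x‖ - SincTensor.gaussSum
                  (SincTensor.weight a a₀ (SincTensor.step C₀ M))
                  (fun k => SincTensor.node a₀ (SincTensor.step C₀ M) k ^ 2) M x|
                ≤ C / a₀ * Real.exp (-(β * Real.sqrt M))) ∧
        ∀ a₀ b : ℝ, 0 < a₀ → 0 < b →
          ∃ C β : ℝ, 0 < C ∧ 0 < β ∧
            ∀ n : ℕ, 1 ≤ n →
              (∀ M : ℕ, 1 ≤ M →
                SincTensor.SincTensorApprox d n b q a a₀ (SincTensor.step C₀ M) M
                  (C * Real.exp (-(β * Real.sqrt M)))) ∧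
              ∀ ε : ℝ, 0 < ε → ∃ M₀ : ℕ, ∀ M : ℕ, M₀ ≤ M →
                ‖SincTensor.projTensor d n b q -
                    SincTensor.sincTensor d n b a a₀ (SincTensor.step C₀ M) M‖
                  ≤ ε * ‖SincTensor.projTensor d n b q‖) := by

  refine ⟨fun d w g M x => SincTensor.gaussSum_eq_sum_prod w g M x,
    fun D b C₀ hD hb hC₀ => SincTensor.exists_strip_gaussSum_bound hD hb hC₀,
    fun δ s m C₀ hδ hs hm hC₀ => SincTensor.exists_laplaceGauss_gaussSum_bound hδ hs hm hC₀,
    fun d δ s m C₀ a₀ b hd hδ hs hm hsm hC₀ ha₀ hb => ?_, fun d q a hd hqa => ?_⟩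
  · obtain ⟨C, β, hC, hβ, H⟩ := SincTensor.exists_sincTensorApprox hd hδ hs hm hsm hC₀ ha₀ hb
    refine ⟨C, β, hC, hβ, fun a q K ha hq n hn => ?_⟩
    obtain ⟨h1, h2⟩ := H a q K ha hq n hn
    exact ⟨h1, fun ε hε => SincTensor.exists_forall_le_mul_of_exp_bound hβ h2
      (fun M hM => (h1 M hM).error) hε⟩
  · obtain ⟨hq, hw⟩ := hqa.isLaplaceGauss_and_sectorWeight hd
    have hδ : 0 < Real.pi / 6 := by positivity
    have hd' : (1 : ℝ) ≤ d := by exact_mod_cast hd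
    refine ⟨hq, fun C₀ hC₀ => ⟨?_, fun a₀ b ha₀ hb => ?_⟩⟩
    -- With `s = 1` and `m = 0` the factor `a₀^{-s}` is the required `1/a₀`.
    · obtain ⟨K, hK, ha⟩ := hw 1 (by norm_num) le_rfl
      obtain ⟨C, β, hC, hβ, H⟩ :=
        SincTensor.exists_laplaceGauss_gaussSum_bound hδ one_pos le_rfl hC₀
      refine ⟨C * K, β, by positivity, hβ, fun a₀ ha₀ M hM x hx => ?_⟩
      refine (H a q K ha hq a₀ ha₀ d M hM x hx).trans (le_of_eq ?_)
      rw [Real.rpow_zero, Real.rpow_neg_one, mul_one, div_eq_mul_inv]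
    -- The tensor estimate needs `s + m < d` strictly, so `s = 1` would fail for `d = 1`.
    · obtain ⟨K, hK, ha⟩ := hw (1 / 2) le_rfl (by norm_num)
      obtain ⟨C, β, hC, hβ, H⟩ := SincTensor.exists_sincTensorApprox hd hδ one_half_pos
        le_rfl (by linarith) hC₀ ha₀ hb
      refine ⟨C * K, β, by positivity, hβ, fun n hn => ?_⟩
      obtain ⟨h1, h2⟩ := H a q K ha hq n hn
      exact ⟨h1, fun ε hε => SincTensor.exists_forall_le_mul_of_exp_bound hβ h2
        (fun M hM => (h1 M hM).error) hε⟩
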